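/- For complex $a,b,c$ with $c\notin\{0,-1,-2,\dots\}$ let ${}_2F_1(a,b;c;z)$ be the analytic continuation of the Gauss series $\sum_{n\ge 0}\frac{(a)_n(b)_n}{(c)_n\,n!}z^n$ to $\mathbb C\smallsetminus[1,\infty)$; at $z=1$ it denotes the sum of the series when $\Re(a+b-c)<0$. For $\rho,\nu\in\mathbb C$ put $$F^{(1)}_{\rho,\nu}(z)={}_2F_1\Big(\tfrac{\rho+\nu}2,\tfrac{1+\rho+\nu}2;1+\nu;z\Big),\qquad F^{(2)}_{\rho,\nu}(z)={}_2F_1\Big(\tfrac{\rho-\nu}2,\tfrac{1+\rho-\nu}2;1-\nu;z\Big),$$ $$G^{(1)}_{\rho,\nu}(z)=z^{-\frac12(\rho+\nu)}F^{(1)}_{\rho,\nu}(1/z),\qquad G^{(2)}_{\rho,\nu}(z)=z^{-\frac12(\rho-\nu)}F^{(2)}_{\rho,\nu}(1/z),$$ $$E^{(1)}_{\rho,\nu}(z)={}_2F_1\Big(\tfrac{\rho+\nu}2,\tfrac{\rho-\nu}2;\tfrac12;z\Big),\qquad E^{(2)}_{\rho,\nu}(z)={}_2F_1\Big(\tfrac{\rho+\nu+1}2,\tfrac{\rho-\nu+1}2;\tfrac32;z\Big).$$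 Let $d\in\mathbb Z$ and $\rho,\mu\in\mathbb C$ be such that $\mu\notin\mathbb Z$ and none of $\rho+\mu+d$, $\rho+\mu-d$, $\rho-\mu+d$, $\rho-\mu-d$ is a non-positive integer. Define $$C^{\rho}_{\mu,d}=-\frac{\sin(\pi(\rho+\mu))}{(2\pi)^{2\rho}\sin(\pi\mu)}\,\frac{\Gamma(\rho+\mu+d)\Gamma(\rho+\mu-d)}{\Gamma(1+\mu+d)\Gamma(1+\mu-d)},\qquad B_{\rho,\mu,d}=\frac{(-1)^d\cos(\pi\mu)-\cos(\pi\rho)}{4\pi^{2\rho+2}},$$ $$A^{(1)}_{\rho,\mu,d}=\Gamma\Big(\frac{\rho+\mu+d}2\Big)\Gamma\Big(\frac{\rho+\mu-d}2\Big)\Gamma\Big(\frac{\rho-\mu-d}2\Big)\Gamma\Big(\frac{\rho-\mu+d}2\Big),$$ $$A^{(2)}_{\rho,\mu,d}=\Gamma\Big(\frac{1+\rho+\mu+d}2\Big)\Gamma\Big(\frac{1+\rho+\mu-d}2\Big)\Gamma\Big(\frac{1+\rho-\mu-d}2\Big)\Gamma\Big(\frac{1+\rho-\mu+d}2\Big).$$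 Powers of $z$ and $\bar z$ are formed with arguments satisfying $\arg\bar z=-\arg z$. Then for all $z\ne 0$ with $\arg z\in(0,2\pi)$ $$4^{-\mu}C^{\rho}_{\mu,d}\,G^{(1)}_{\rho,\mu+d}(z)\,G^{(1)}_{\rho,\mu-d}(\bar z)+4^{\mu}C^{\rho}_{-\mu,-d}\,G^{(2)}_{\rho,\mu+d}(z)\,G^{(2)}_{\rho,\mu-d}(\bar z)$$ $$=B_{\rho,\mu,d}A^{(1)}_{\rho,\mu,d}\,E^{(1)}_{\rho,\mu+d}(z)\,E^{(1)}_{\rho,\mu-d}(\bar z)+B_{\rho,\mu,d+1}A^{(2)}_{\rho,\mu,d}\cdot 4|z|\,E^{(2)}_{\rho,\mu+d}(z)\,E^{(2)}_{\rho,\mu-d}(\bar z).\qquad(*)$$ Moreover, if $\Re\rho<\tfrac12$, there is a continuous function $f$ on the whole complex plane that equals the left-hand side of $(*)$ for every $z\notin[0,1)$ and every choice of $\arg z$, and equals the right-hand side of $(*)$ for every $z\notin(1,\infty)$. This $f$ is real-analytic on $\mathbb C\smallsetminus\{0,1\}$, and $w\mapsto f(w^2)$ is real-analytic on $\mathbb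 C\smallsetminus\{1,-1\}$. -/

import Mathlib

/-- The complex plane cut along the real half-line `[1, ∞)`. -/
def cutPlane : Set ℂ := (Complex.ofReal '' Set.Ici (1 : ℝ))ᶜ

/-- `f` continues the Gauss series `∑ (a)ₙ (b)ₙ / ((c)ₙ n!) zⁿ`, `|z| < 1`, analytically to the
plane cut along `[1, ∞)`. -/
def IsGaussContinuation (a b c : ℂ) (f : ℂ → ℂ) : Prop :=
  AnalyticOnNhd ℂ f cutPlane ∧ Set.EqOn f (ordinaryHypergeometric a b c) (Metric.ball 0 1)

/-- The analytic continuation of the Gauss series is unique. -/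
theorem IsGaussContinuation.eqOn {a b c : ℂ} {f g : ℂ → ℂ} (hf : IsGaussContinuation a b c f)
    (hg : IsGaussContinuation a b c g) : Set.EqOn f g cutPlane := by
  have h0 : (0 : ℂ) ∈ cutPlane := by
    rintro ⟨x, hx, h⟩
    have : x = 0 := by exact_mod_cast h
    simp [this] at hx
    linarith
  have hs : StarConvex ℝ (0 : ℂ) cutPlane := by
    rw [starConvex_iff_forall_pos h0]
    rintro z hz s t hs ht hst ⟨x, hx, h⟩
    apply hz
    have ht1 : t ≤ 1 := by linarith
    refine ⟨x / t, ?_, ?_⟩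
    · simp only [Set.mem_Ici] at hx ⊢
      rw [le_div_iff₀ ht]
      linarith
    · have : (t : ℂ) ≠ 0 := by exact_mod_cast ht.ne'
      simp only [smul_zero, zero_add, Complex.real_smul] at h
      rw [Complex.ofReal_div, h]
      field_simp
  refine hf.1.eqOn_of_preconnected_of_eventuallyEq hg.1
    (hs.isPathConnected h0).isConnected.isPreconnected h0 ?_
  filter_upwards [Metric.ball_mem_nhds (0 : ℂ) one_pos] with z hz
  rw [hf.2 hz, hg.2 hz]

open Classical in
/-- The hypergeometric function `₂F₁(a, b; c; z)`: the analytic continuation of the Gauss series to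
the plane cut along `[1, ∞)`. On the cut the value is that of the series itself, which is
meaningful at the point `z = 1` when `Re (a + b - c) < 0`. -/
noncomputable def hyp2F1 (a b c z : ℂ) : ℂ :=
  if h : z ∈ cutPlane ∧ ∃ f, IsGaussContinuation a b c f then h.2.choose z
  else ordinaryHypergeometric a b c z

/-- `F⁽¹⁾_{ρ,ν}(z)`. -/
noncomputable def hypF1 (ρ ν z : ℂ) : ℂ := hyp2F1 ((ρ + ν) / 2) ((1 + ρ + ν) / 2) (1 + ν) z

/-- `F⁽²⁾_{ρ,ν}(z)`. -/
noncomputable def hypF2 (ρ ν z : ℂ) : ℂ := hyp2F1 ((ρ - ν) / 2) ((1 + ρ - ν) / 2) (1 - ν) z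

/-- The power `z ^ s` formed with the argument `θ` of `z`. -/
noncomputable def powArg (z : ℂ) (θ : ℝ) (s : ℂ) : ℂ :=
  Complex.exp (s * ((Real.log ‖z‖ : ℂ) + θ * Complex.I))

/-- `G⁽¹⁾_{ρ,ν}(z) = z ^ (-(ρ + ν) / 2) F⁽¹⁾_{ρ,ν}(1 / z)`, where `z` has the argument `θ`. -/
noncomputable def hypG1 (ρ ν z : ℂ) (θ : ℝ) : ℂ :=
  powArg z θ (-(ρ + ν) / 2) * hypF1 ρ ν (1 / z)

/-- `G⁽²⁾_{ρ,ν}(z) = z ^ (-(ρ - ν) / 2) F⁽²⁾_{ρ,ν}(1 / z)`, where `z` has the argument `θ`. -/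
noncomputable def hypG2 (ρ ν z : ℂ) (θ : ℝ) : ℂ :=
  powArg z θ (-(ρ - ν) / 2) * hypF2 ρ ν (1 / z)

/-- `E⁽¹⁾_{ρ,ν}(z)`. -/
noncomputable def hypE1 (ρ ν z : ℂ) : ℂ := hyp2F1 ((ρ + ν) / 2) ((ρ - ν) / 2) (1 / 2) z

/-- `E⁽²⁾_{ρ,ν}(z)`. -/
noncomputable def hypE2 (ρ ν z : ℂ) : ℂ := hyp2F1 ((ρ + ν + 1) / 2) ((ρ - ν + 1) / 2) (3 / 2) z

/-- The constant `C^ρ_{μ,d}`. -/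
noncomputable def coeffC (ρ μ : ℂ) (d : ℤ) : ℂ :=
  -(Complex.sin (Real.pi * (ρ + μ)) /
      ((2 * Real.pi : ℂ) ^ (2 * ρ) * Complex.sin (Real.pi * μ))) *
    (Complex.Gamma (ρ + μ + d) * Complex.Gamma (ρ + μ - d) /
      (Complex.Gamma (1 + μ + d) * Complex.Gamma (1 + μ - d)))

/-- The constant `B_{ρ,μ,d}`. -/
noncomputable def coeffB (ρ μ : ℂ) (d : ℤ) : ℂ :=
  ((-1 : ℂ) ^ d * Complex.cos (Real.pi * μ) - Complex.cos (Real.pi * ρ)) /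
    (4 * (Real.pi : ℂ) ^ (2 * ρ + 2))

/-- The constant `A⁽¹⁾_{ρ,μ,d}`. -/
noncomputable def coeffA1 (ρ μ : ℂ) (d : ℤ) : ℂ :=
  Complex.Gamma ((ρ + μ + d) / 2) * Complex.Gamma ((ρ + μ - d) / 2) *
    Complex.Gamma ((ρ - μ - d) / 2) * Complex.Gamma ((ρ - μ + d) / 2)

/-- The constant `A⁽²⁾_{ρ,μ,d}`. -/
noncomputable def coeffA2 (ρ μ : ℂ) (d : ℤ) : ℂ :=
  Complex.Gamma ((1 + ρ + μ + d) / 2) * Complex.Gamma ((1 + ρ + μ - d) / 2) *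
    Complex.Gamma ((1 + ρ - μ - d) / 2) * Complex.Gamma ((1 + ρ - μ + d) / 2)

/-- The combination of solutions at infinity; if `z` has the argument `θ`, its conjugate has the
argument `-θ`. -/
noncomputable def combInfinity (ρ μ : ℂ) (d : ℤ) (z : ℂ) (θ : ℝ) : ℂ :=
  (4 : ℂ) ^ (-μ) * coeffC ρ μ d *
      hypG1 ρ (μ + d) z θ * hypG1 ρ (μ - d) (starRingEnd ℂ z) (-θ) +
    (4 : ℂ) ^ μ * coeffC ρ (-μ) (-d) *
      hypG2 ρ (μ + d) z θ * hypG2 ρ (μ - d) (starRingEnd ℂ z) (-θ)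

/-- The combination of solutions at zero. -/
noncomputable def combZero (ρ μ : ℂ) (d : ℤ) (z : ℂ) : ℂ :=
  coeffB ρ μ d * coeffA1 ρ μ d * hypE1 ρ (μ + d) z * hypE1 ρ (μ - d) (starRingEnd ℂ z) +
    coeffB ρ μ (d + 1) * coeffA2 ρ μ d * (4 * (‖z‖ : ℂ)) *
      hypE2 ρ (μ + d) z * hypE2 ρ (μ - d) (starRingEnd ℂ z)

/-!
Both sides of the identity are bilinear in solutions of hypergeometric equations, evaluated at `z`
and at its conjugate, so everything comes down to the connection formula between the solutions at
infinity and those at zero. Gauss's quadratic transformation continues `₂F₁(a, a + 1/2; c; z)` to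
the cut plane, hence yields the solution `(-z) ^ (-a) ₂F₁(a, a + 1/2; a - b + 1; 1 / z)` at infinity
of the equation with parameters `a`, `b`, `1/2`. It is a combination of the Frobenius basis
`₂F₁(a, b; 1/2; z)` and `(-z) ^ (1/2) ₂F₁(a + 1/2, b + 1/2; 3/2; z)` at zero. When `a` and `b` lie
in the left half-plane, the two coefficients are determined by the boundary values at `z = 1` from
above and from below, which Gauss's summation theorem evaluates; the general case follows by
analytic continuation along `(a + t, b + t)`. Inverting the connection matrix in turn continues the
two functions at zero.

Suitably normalised, the connection formula reads `sin α * U - cos α * V`, where `U` and `V` are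
invariant under `ν ↦ -ν`; passing to `-ν` replaces `α` by `β`. In the combination at infinity the
terms that mix even and odd solutions cancel by an addition formula, which leaves the combination at
zero. For `Re ρ < 1/2` the coefficients of all Gauss series involved are summable, so both sides are
continuous up to the unit circle, and they agree at `z = 1` by continuity.
-/

section PochhammerSymbol

open Filter Topology
open scoped Nat

theorem ascPochhammer_eval_eq_prod {R : Type*} [CommSemiring R] (s : R) (n : ℕ) :
    (ascPochhammer R n).eval s = ∏ j ∈ Finset.range n, (s + j) := by
  induction n with
  | zero => simp
  | succ n ih => rw [ascPochhammer_succ_eval, Finset.prod_range_succ, ih]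

theorem ascPochhammer_eval_ne_zero {R : Type*} [CommRing R] [IsDomain R] {s : R}
    (hs : ∀ k : ℕ, s ≠ -k) (n : ℕ) : (ascPochhammer R n).eval s ≠ 0 := by
  rw [ascPochhammer_eval_eq_prod, Finset.prod_ne_zero_iff]
  exact fun j _ => mt eq_neg_of_add_eq_zero_left (hs j)

theorem norm_ascPochhammer_eval_le_eval_add_natCast {c : ℂ} (hc : 0 < c.re) (m n : ℕ) :
    ‖(ascPochhammer ℂ n).eval c‖ ≤ ‖(ascPochhammer ℂ n).eval (c + m)‖ := by
  simp only [ascPochhammer_eval_eq_prod, norm_prod]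
  refine Finset.prod_le_prod (fun _ _ => norm_nonneg _) fun j _ => ?_
  simp only [Complex.norm_eq_sqrt_sq_add_sq, Complex.add_re, Complex.natCast_re, Complex.add_im,
    Complex.natCast_im, add_zero]
  gcongr
  simp

theorem norm_ascPochhammer_eval_le_of_norm_le {a : ℂ} {R : ℝ} (h : ‖a‖ ≤ R) (n : ℕ) :
    ‖(ascPochhammer ℂ n).eval a‖ ≤ ‖(ascPochhammer ℂ n).eval (R : ℂ)‖ := by
  simp only [ascPochhammer_eval_eq_prod, norm_prod]
  refine Finset.prod_le_prod (fun _ _ => norm_nonneg _) fun j _ => ?_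
  have hR : 0 ≤ R := (norm_nonneg _).trans h
  calc ‖a + j‖ ≤ ‖a‖ + ‖(j : ℂ)‖ := norm_add_le _ _
    _ ≤ R + j := by rw [Complex.norm_natCast]; gcongr
    _ = ‖(R : ℂ) + j‖ := by
      rw [← Complex.ofReal_natCast, ← Complex.ofReal_add, Complex.norm_real,
        Real.norm_of_nonneg (by positivity)]

theorem tendsto_inv_ascPochhammer_eval_add_natCast (c : ℂ) {n : ℕ} (hn : n ≠ 0) :
    Tendsto (fun m : ℕ => ((ascPochhammer ℂ n).eval (c + m))⁻¹) atTop (𝓝 0) := by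
  have hdeg : 0 < (ascPochhammer ℂ n).degree := by
    rw [← Polynomial.natDegree_pos_iff_degree_pos, ascPochhammer_natDegree]
    exact hn.pos
  have hnorm : Tendsto (fun m : ℕ => ‖c + m‖) atTop atTop :=
    tendsto_norm_cobounded_atTop.comp
      ((tendsto_const_add_cobounded c).comp tendsto_natCast_atTop_cobounded)
  exact tendsto_inv₀_cobounded.comp
    (tendsto_norm_atTop_iff_cobounded.1 (Polynomial.tendsto_norm_atTop _ hdeg hnorm))

theorem tendsto_ascPochhammer_eval_mul_div (s : ℂ) :
    Tendsto (fun n : ℕ => (ascPochhammer ℂ n).eval s * n / ((n : ℂ) ^ s * n !)) atTop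
      (𝓝 (Complex.Gamma s)⁻¹) := by
  by_cases hs : ∀ k : ℕ, s ≠ -k
  · have h := ((Complex.GammaSeq_tendsto_Gamma s).inv₀ (Complex.Gamma_ne_zero hs)).mul
      (tendsto_natCast_div_add_atTop s)
    rw [mul_one] at h
    refine h.congr fun n => ?_
    have hsn : s + n ≠ 0 := mt eq_neg_of_add_eq_zero_left (hs n)
    rw [Complex.GammaSeq, inv_div, ← ascPochhammer_eval_eq_prod, ascPochhammer_succ_eval,
      add_comm (n : ℂ) s]
    field_simp
  · push Not at hs
    obtain ⟨k, rfl⟩ := hs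
    rw [Complex.Gamma_neg_nat_eq_zero, inv_zero]
    refine tendsto_const_nhds.congr' ?_
    filter_upwards [eventually_gt_atTop k] with n hn
    rw [ascPochhammer_eval_neg_coe_nat_of_lt hn, zero_mul, zero_div]

end PochhammerSymbol

section Coefficients

open Asymptotics Filter Topology
open scoped Nat

theorem ordinaryHypergeometricCoefficient_zero {𝕂 : Type*} [Field 𝕂] (a b c : 𝕂) :
    ordinaryHypergeometricCoefficient a b c 0 = 1 := by
  simp [ordinaryHypergeometricCoefficient]

section Field

variable {𝕂 : Type*} [Field 𝕂] [CharZero 𝕂] {a b c : 𝕂}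

theorem ordinaryHypergeometricCoefficient_succ {n : ℕ} (hc : c ≠ -n) :
    ordinaryHypergeometricCoefficient a b c (n + 1) =
      (a + n) * (b + n) / ((n + 1) * (c + n)) * ordinaryHypergeometricCoefficient a b c n := by
  have hcn : c + n ≠ 0 := mt eq_neg_of_add_eq_zero_left hc
  have hn : (n : 𝕂) + 1 ≠ 0 := n.cast_add_one_ne_zero
  simp only [ordinaryHypergeometricCoefficient, ascPochhammer_succ_eval, Nat.factorial_succ,
    Nat.cast_mul, Nat.cast_succ, mul_inv]
  field_simp

theorem ordinaryHypergeometricCoefficient_succ_mul {n : ℕ} (hc : c ≠ -n) :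
    (n + 1) * (c + n) * ordinaryHypergeometricCoefficient a b c (n + 1) =
      (a + n) * (b + n) * ordinaryHypergeometricCoefficient a b c n := by
  have hcn : c + n ≠ 0 := mt eq_neg_of_add_eq_zero_left hc
  have hn : (n : 𝕂) + 1 ≠ 0 := n.cast_add_one_ne_zero
  rw [ordinaryHypergeometricCoefficient_succ hc]
  field_simp

theorem ordinaryHypergeometricCoefficient_add_one_right (hc : ∀ k : ℕ, c ≠ -k) (n : ℕ) :
    ordinaryHypergeometricCoefficient a b (c + 1) n =
      c / (c + n) * ordinaryHypergeometricCoefficient a b c n := by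
  have hcn (k : ℕ) : c + k ≠ 0 := mt eq_neg_of_add_eq_zero_left (hc k)
  induction n with
  | zero => simp [ordinaryHypergeometricCoefficient_zero, div_self (by simpa using hcn 0)]
  | succ n ih =>
    have hcn' : c + 1 + n ≠ 0 := by simpa [add_right_comm, add_assoc] using hcn (n + 1)
    have hcn₁ := hcn n
    rw [ordinaryHypergeometricCoefficient_succ (mt add_eq_zero_iff_eq_neg.2 hcn'),
      ordinaryHypergeometricCoefficient_succ (hc n), ih, Nat.cast_succ, ← add_assoc,
      add_right_comm c n 1]
    field_simp

end Field

section Complex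

variable {a b c : ℂ}

theorem tendsto_ordinaryHypergeometricCoefficient_mul (hc : ∀ k : ℕ, c ≠ -k) :
    Tendsto (fun n : ℕ => ordinaryHypergeometricCoefficient a b c n *
      ((n : ℂ) ^ (c - a - b) * n)) atTop
      (𝓝 ((Complex.Gamma a)⁻¹ * (Complex.Gamma b)⁻¹ / (Complex.Gamma c)⁻¹)) := by
  refine (((tendsto_ascPochhammer_eval_mul_div a).mul (tendsto_ascPochhammer_eval_mul_div b)).div
    (tendsto_ascPochhammer_eval_mul_div c) (inv_ne_zero (Complex.Gamma_ne_zero hc))).congr' ?_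
  filter_upwards [eventually_ne_atTop 0] with n hn
  have hn0 : (n : ℂ) ≠ 0 := Nat.cast_ne_zero.2 hn
  have hfac : (n ! : ℂ) ≠ 0 := Nat.cast_ne_zero.2 n.factorial_ne_zero
  have hpoch := ascPochhammer_eval_ne_zero hc n
  have hpow (s : ℂ) : (n : ℂ) ^ s ≠ 0 := by simp [Complex.cpow_eq_zero_iff, hn0]
  have ha := hpow a
  have hb := hpow b
  have hc := hpow c
  simp only [Pi.div_apply, ordinaryHypergeometricCoefficient, Complex.cpow_sub _ _ hn0]
  field_simp

theorem isBigO_ordinaryHypergeometricCoefficient (hc : ∀ k : ℕ, c ≠ -k) :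
    ordinaryHypergeometricCoefficient a b c =O[atTop]
      fun n : ℕ => (n : ℝ) ^ ((a + b - c).re - 1) := by
  have hbdd := (tendsto_ordinaryHypergeometricCoefficient_mul (a := a) (b := b) hc).isBigO_one ℝ
  have hinv : (fun n : ℕ => ((n : ℂ) ^ (c - a - b) * n)⁻¹) =O[atTop]
      fun n : ℕ => (n : ℝ) ^ ((a + b - c).re - 1) := by
    refine .of_norm_eventuallyLE ?_
    filter_upwards [eventually_gt_atTop 0] with n hn
    have hn0 : (0 : ℝ) < n := Nat.cast_pos.2 hn
    rw [norm_inv, norm_mul, Complex.norm_natCast_cpow_of_pos hn, Complex.norm_natCast,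
      ← Real.rpow_add_one hn0.ne', ← Real.rpow_neg hn0.le]
    apply le_of_eq
    congr 1
    simp only [Complex.sub_re, Complex.add_re]
    ring
  refine (hbdd.mul hinv).congr' ?_ (.of_forall fun n => one_mul _)
  filter_upwards [eventually_ne_atTop 0] with n hn
  have hn0 : (n : ℂ) ≠ 0 := Nat.cast_ne_zero.2 hn
  exact mul_inv_cancel_right₀ (mul_ne_zero (by simp [Complex.cpow_eq_zero_iff, hn0]) hn0) _

theorem summable_norm_ordinaryHypergeometricCoefficient (hc : ∀ k : ℕ, c ≠ -k)
    (h : (a + b - c).re < 0) :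
    Summable fun n => ‖ordinaryHypergeometricCoefficient a b c n‖ :=
  summable_of_isBigO_nat (Real.summable_nat_rpow.2 (by linarith))
    (isBigO_ordinaryHypergeometricCoefficient hc).norm_left

theorem tendsto_natCast_mul_ordinaryHypergeometricCoefficient (hc : ∀ k : ℕ, c ≠ -k)
    (h : (a + b - c).re < 0) :
    Tendsto (fun n : ℕ => n * ordinaryHypergeometricCoefficient a b c n) atTop (𝓝 0) := by
  have hpow : Tendsto (fun n : ℕ => (n : ℝ) ^ (a + b - c).re) atTop (𝓝 0) := by
    simpa [Function.comp_def] using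
      (tendsto_rpow_neg_atTop (neg_pos.2 h)).comp tendsto_natCast_atTop_atTop
  have hcast : (fun n : ℕ => (n : ℂ)) =O[atTop] fun n : ℕ => (n : ℝ) :=
    isBigO_of_le _ fun n => by simp
  refine (hcast.mul (isBigO_ordinaryHypergeometricCoefficient hc)).trans_tendsto
    (hpow.congr' ?_)
  filter_upwards [eventually_gt_atTop 0] with n hn
  rw [Real.rpow_sub_one (Nat.cast_ne_zero.2 hn.ne'),
    mul_div_cancel₀ _ (Nat.cast_ne_zero.2 hn.ne')]

end Complex

end Coefficients

section GaussSeries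

open scoped Nat

theorem ordinaryHypergeometric_eq_tsum_coefficient {𝕂 : Type*} [Field 𝕂] [TopologicalSpace 𝕂]
    [IsTopologicalRing 𝕂] (a b c z : 𝕂) :
    ordinaryHypergeometric a b c z = ∑' n, ordinaryHypergeometricCoefficient a b c n * z ^ n := by
  rw [ordinaryHypergeometric_eq_tsum]
  rfl

theorem ordinaryHypergeometric_comm {𝕂 𝔸 : Type*} [Field 𝕂] [Ring 𝔸] [Algebra 𝕂 𝔸]
    [TopologicalSpace 𝔸] [IsTopologicalRing 𝔸] (a b c : 𝕂) :
    (ordinaryHypergeometric a b c : 𝔸 → 𝔸) = ordinaryHypergeometric b a c := by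
  funext z
  rw [ordinaryHypergeometric, ordinaryHypergeometricSeries_symm, ordinaryHypergeometric]

theorem one_le_radius_ordinaryHypergeometricSeries {𝕂 : Type*} (𝔸 : Type*) [RCLike 𝕂]
    [NormedDivisionRing 𝔸] [NormedAlgebra 𝕂 𝔸] (a b c : 𝕂) :
    1 ≤ (ordinaryHypergeometricSeries 𝔸 a b c).radius := by
  by_cases ha : ∃ k : ℕ, a = -k
  · obtain ⟨k, rfl⟩ := ha
    simp [ordinaryHypergeometric_radius_top_of_neg_nat₁]
  by_cases hb : ∃ k : ℕ, b = -k
  · obtain ⟨k, rfl⟩ := hb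
    simp [ordinaryHypergeometric_radius_top_of_neg_nat₂]
  by_cases hc : ∃ k : ℕ, c = -k
  · obtain ⟨k, rfl⟩ := hc
    simp [ordinaryHypergeometric_radius_top_of_neg_nat₃]
  push Not at ha hb hc
  simp only [ne_eq, ← neg_eq_iff_eq_neg] at ha hb hc
  exact (ordinaryHypergeometricSeries_radius_eq_one 𝔸 a b c fun k =>
    ⟨Ne.symm (ha k), Ne.symm (hb k), Ne.symm (hc k)⟩).ge

theorem hasFPowerSeriesOnBall_ordinaryHypergeometric {𝕂 𝔸 : Type*} [RCLike 𝕂]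
    [NormedDivisionRing 𝔸] [NormedAlgebra 𝕂 𝔸] [CompleteSpace 𝔸] (a b c : 𝕂) :
    HasFPowerSeriesOnBall (ordinaryHypergeometric a b c : 𝔸 → 𝔸)
      (ordinaryHypergeometricSeries 𝔸 a b c) 0 1 :=
  ((ordinaryHypergeometricSeries 𝔸 a b c).hasFPowerSeriesOnBall
    (zero_lt_one.trans_le (one_le_radius_ordinaryHypergeometricSeries 𝔸 a b c))).mono one_pos
    (one_le_radius_ordinaryHypergeometricSeries 𝔸 a b c)

theorem analyticOnNhd_ordinaryHypergeometric {𝕂 𝔸 : Type*} [RCLike 𝕂] [NormedDivisionRing 𝔸]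
    [NormedAlgebra 𝕂 𝔸] [CompleteSpace 𝔸] (a b c : 𝕂) :
    AnalyticOnNhd 𝕂 (ordinaryHypergeometric a b c : 𝔸 → 𝔸) (Metric.ball 0 1) := by
  simpa only [← ENNReal.ofReal_one, Metric.eball_ofReal] using
    (hasFPowerSeriesOnBall_ordinaryHypergeometric (𝔸 := 𝔸) a b c).analyticOnNhd

theorem continuousOn_ordinaryHypergeometric_closedBall {a b c : ℂ} (hc : ∀ k : ℕ, c ≠ -k)
    (h : (a + b - c).re < 0) :
    ContinuousOn (ordinaryHypergeometric a b c : ℂ → ℂ) (Metric.closedBall 0 1) := by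
  rw [funext (ordinaryHypergeometric_eq_tsum_coefficient a b c)]
  refine continuousOn_tsum (fun n => by fun_prop)
    (summable_norm_ordinaryHypergeometricCoefficient hc h) fun n z hz => ?_
  rw [norm_mul, norm_pow]
  exact mul_le_of_le_one_right (norm_nonneg _)
    (pow_le_one₀ (norm_nonneg _) (mem_closedBall_zero_iff.1 hz))

theorem summable_norm_ordinaryHypergeometricCoefficient_mul_pow {𝕂 : Type*} [RCLike 𝕂]
    (a b c : 𝕂) {z : 𝕂} (hz : ‖z‖ < 1) :
    Summable fun n => ‖ordinaryHypergeometricCoefficient a b c n‖ * ‖z‖ ^ n := by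
  have hz' : z ∈ Metric.eball 0 (ordinaryHypergeometricSeries 𝕂 a b c).radius := by
    refine Metric.eball_subset_eball (one_le_radius_ordinaryHypergeometricSeries 𝕂 a b c) ?_
    rwa [← ENNReal.ofReal_one, Metric.eball_ofReal, mem_ball_zero_iff]
  refine ((ordinaryHypergeometricSeries 𝕂 a b c).summable_norm_apply hz').congr fun n => ?_
  rw [ordinaryHypergeometricSeries_apply_eq, smul_eq_mul, norm_mul, norm_pow]

theorem differentiable_ordinaryHypergeometric_comp {α β : ℂ → ℂ} (hα : Differentiable ℂ α)
    (hβ : Differentiable ℂ β) (c : ℂ) {z : ℂ} (hz : ‖z‖ < 1) :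
    Differentiable ℂ fun t => ordinaryHypergeometric (α t) (β t) c z := by
  intro t₀
  set R : ℝ := ‖α t₀‖ + ‖β t₀‖ + 1
  set U : Set ℂ := {t | ‖α t‖ < R ∧ ‖β t‖ < R}
  have hU : IsOpen U :=
    (isOpen_lt hα.continuous.norm continuous_const).inter
      (isOpen_lt hβ.continuous.norm continuous_const)
  have ht₀ : t₀ ∈ U :=
    ⟨by simp only [R]; linarith [norm_nonneg (β t₀)],
      by simp only [R]; linarith [norm_nonneg (α t₀)]⟩
  simp only [ordinaryHypergeometric_eq_tsum_coefficient]
  refine (Complex.differentiableOn_tsum_of_summable_norm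
    (summable_norm_ordinaryHypergeometricCoefficient_mul_pow (R : ℂ) (R : ℂ) c hz) (fun n => ?_) hU
    fun n t ht => ?_).differentiableAt (hU.mem_nhds ht₀)
  · have hpα := (ascPochhammer ℂ n).differentiable.comp hα
    have hpβ := (ascPochhammer ℂ n).differentiable.comp hβ
    exact (((hpα.const_mul _).mul hpβ).mul_const _ |>.mul_const _).differentiableOn
  · simp only [ordinaryHypergeometricCoefficient, norm_mul, norm_pow]
    gcongr
    · exact norm_ascPochhammer_eval_le_of_norm_le ht.1.le n
    · exact norm_ascPochhammer_eval_le_of_norm_le ht.2.le n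

end GaussSeries

section GaussSummation

open Filter Topology
open scoped Nat

variable {a b c : ℂ}

theorem ne_neg_natCast_of_re_pos (hc : 0 < c.re) (k : ℕ) : c ≠ -k := by
  rintro rfl
  simp only [Complex.neg_re, Complex.natCast_re, Left.neg_pos_iff] at hc
  exact hc.not_ge k.cast_nonneg

theorem sum_range_ordinaryHypergeometricCoefficient_contiguous (hc : ∀ k : ℕ, c ≠ -k) (N : ℕ) :
    ∑ n ∈ Finset.range N, (c * (c - a - b) * ordinaryHypergeometricCoefficient a b c n -
      (c - a) * (c - b) * ordinaryHypergeometricCoefficient a b (c + 1) n) =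
    -c * (N * ordinaryHypergeometricCoefficient a b c N) := by
  induction N with
  | zero => simp
  | succ n ih =>
    have hcn : c + n ≠ 0 := mt eq_neg_of_add_eq_zero_left (hc n)
    have hn : (n : ℂ) + 1 ≠ 0 := n.cast_add_one_ne_zero
    rw [Finset.sum_range_succ, ih, ordinaryHypergeometricCoefficient_add_one_right hc,
      ordinaryHypergeometricCoefficient_succ (hc n), Nat.cast_succ]
    field_simp
    ring

theorem ordinaryHypergeometric_one_contiguous (hc : ∀ k : ℕ, c ≠ -k) (h : (a + b - c).re < 0) :
    c * (c - a - b) * ordinaryHypergeometric a b c (1 : ℂ) =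
      (c - a) * (c - b) * ordinaryHypergeometric a b (c + 1) (1 : ℂ) := by
  have hc' (k : ℕ) : c + 1 ≠ -k := fun hk => hc (k + 1) (by push_cast; linear_combination hk)
  have h' : (a + b - (c + 1)).re < 0 := by
    rw [← sub_sub, Complex.sub_re, Complex.one_re]
    linarith
  have hs := (summable_norm_ordinaryHypergeometricCoefficient hc h).of_norm.hasSum
  have hs' := (summable_norm_ordinaryHypergeometricCoefficient hc' h').of_norm.hasSum
  have hlim := ((hs.mul_left (c * (c - a - b))).sub
    (hs'.mul_left ((c - a) * (c - b)))).tendsto_sum_nat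
  simp only [sum_range_ordinaryHypergeometricCoefficient_contiguous hc] at hlim
  have hdiff := tendsto_nhds_unique hlim
    ((tendsto_natCast_mul_ordinaryHypergeometricCoefficient hc h).const_mul (-c))
  simp only [ordinaryHypergeometric_eq_tsum_coefficient, one_pow, mul_one]
  linear_combination hdiff

theorem ordinaryHypergeometric_one_mul_ascPochhammer (hc : ∀ k : ℕ, c ≠ -k)
    (h : (a + b - c).re < 0) (m : ℕ) :
    (ascPochhammer ℂ m).eval c * (ascPochhammer ℂ m).eval (c - a - b) *
      ordinaryHypergeometric a b c (1 : ℂ) =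
    (ascPochhammer ℂ m).eval (c - a) * (ascPochhammer ℂ m).eval (c - b) *
      ordinaryHypergeometric a b (c + m) (1 : ℂ) := by
  induction m with
  | zero => simp
  | succ m ih =>
    have hc' (k : ℕ) : c + m ≠ -k := fun hk =>
      hc (k + m) (by push_cast; linear_combination hk)
    have h' : (a + b - (c + m)).re < 0 := by
      rw [← sub_sub, Complex.sub_re, Complex.natCast_re]
      linarith [m.cast_nonneg (α := ℝ)]
    have hstep := ordinaryHypergeometric_one_contiguous hc' h'
    rw [Nat.cast_succ, ← add_assoc]
    simp only [ascPochhammer_succ_eval]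
    linear_combination (c + m) * (c - a - b + m) * ih +
      (ascPochhammer ℂ m).eval (c - a) * (ascPochhammer ℂ m).eval (c - b) * hstep

theorem tendsto_ordinaryHypergeometricCoefficient_add_natCast (a b c : ℂ) (n : ℕ) :
    Tendsto (fun m : ℕ => ordinaryHypergeometricCoefficient a b (c + m) n) atTop
      (𝓝 (if n = 0 then 1 else 0)) := by
  split_ifs with hn
  · simp [hn, ordinaryHypergeometricCoefficient_zero]
  · simpa using (tendsto_inv_ascPochhammer_eval_add_natCast c hn).const_mul
      ((n ! : ℂ)⁻¹ * (ascPochhammer ℂ n).eval a * (ascPochhammer ℂ n).eval b)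

theorem tendsto_ordinaryHypergeometric_one_add_natCast (h : (a + b - c).re < 0) :
    Tendsto (fun m : ℕ => ordinaryHypergeometric a b (c + m) (1 : ℂ)) atTop (𝓝 1) := by
  obtain ⟨m₀, hm₀⟩ := exists_nat_gt (-c.re)
  have hre : 0 < (c + m₀).re := by
    rw [Complex.add_re, Complex.natCast_re]
    linarith
  have hc₀ := ne_neg_natCast_of_re_pos hre
  have h₀ : (a + b - (c + m₀)).re < 0 := by
    rw [← sub_sub, Complex.sub_re, Complex.natCast_re]
    linarith [m₀.cast_nonneg (α := ℝ)]
  rw [← tendsto_add_atTop_iff_nat m₀]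
  simp only [ordinaryHypergeometric_eq_tsum_coefficient, one_pow, mul_one]
  rw [← tsum_ite_eq (0 : ℕ) (fun _ => (1 : ℂ))]
  refine tendsto_tsum_of_dominated_convergence
    (summable_norm_ordinaryHypergeometricCoefficient hc₀ h₀)
    (fun n => (tendsto_ordinaryHypergeometricCoefficient_add_natCast a b c n).comp
      (tendsto_add_atTop_nat m₀))
    (.of_forall fun m n => ?_)
  simp only [ordinaryHypergeometricCoefficient, norm_mul, norm_inv, Nat.cast_add,
    add_comm (m : ℂ), ← add_assoc]
  gcongr
  · exact norm_pos_iff.2 (ascPochhammer_eval_ne_zero hc₀ n)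
  · exact norm_ascPochhammer_eval_le_eval_add_natCast hre m n

/-- **Gauss's summation theorem**. -/
theorem ordinaryHypergeometric_one (hc : ∀ k : ℕ, c ≠ -k) (h : (a + b - c).re < 0) :
    ordinaryHypergeometric a b c (1 : ℂ) = Complex.Gamma c * Complex.Gamma (c - a - b) *
      (Complex.Gamma (c - a))⁻¹ * (Complex.Gamma (c - b))⁻¹ := by
  have hcab : ∀ k : ℕ, c - a - b ≠ -k := ne_neg_natCast_of_re_pos <| by
    rw [← neg_pos, ← Complex.neg_re] at h
    convert h using 2
    ring
  have hΓc := Complex.Gamma_ne_zero hc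
  have hΓcab := Complex.Gamma_ne_zero hcab
  have hleft := ((tendsto_ascPochhammer_eval_mul_div c).mul
    (tendsto_ascPochhammer_eval_mul_div (c - a - b))).mul_const
      (ordinaryHypergeometric a b c (1 : ℂ))
  have hright := ((tendsto_ascPochhammer_eval_mul_div (c - a)).mul
    (tendsto_ascPochhammer_eval_mul_div (c - b))).mul
      (tendsto_ordinaryHypergeometric_one_add_natCast h)
  have hlim := tendsto_nhds_unique_of_eventuallyEq hleft hright (by
    filter_upwards [eventually_ne_atTop 0] with n hn
    have hn0 : (n : ℂ) ≠ 0 := Nat.cast_ne_zero.2 hn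
    have hpow : (n : ℂ) ^ c * (n : ℂ) ^ (c - a - b) = (n : ℂ) ^ (c - a) * (n : ℂ) ^ (c - b) := by
      rw [← Complex.cpow_add _ _ hn0, ← Complex.cpow_add _ _ hn0]
      ring_nf
    have hrec := ordinaryHypergeometric_one_mul_ascPochhammer hc h n
    rw [div_mul_div_comm, div_mul_div_comm, mul_mul_mul_comm ((n : ℂ) ^ c), hpow,
      mul_mul_mul_comm ((n : ℂ) ^ (c - a)), div_mul_eq_mul_div, div_mul_eq_mul_div]
    congr 1
    linear_combination (n : ℂ) ^ 2 * hrec)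
  field_simp at hlim ⊢
  linear_combination hlim

end GaussSummation

section HypergeometricEquation

open Filter Topology

theorem exists_hasFPowerSeriesOnBall_deriv {𝕜 E : Type*} [NontriviallyNormedField 𝕜]
    [NormedAddCommGroup E] [NormedSpace 𝕜 E] [CompleteSpace E] {f : 𝕜 → E}
    {p : FormalMultilinearSeries 𝕜 𝕜 E} {x : 𝕜} {r : ENNReal} (h : HasFPowerSeriesOnBall f p x r) :
    ∃ q : FormalMultilinearSeries 𝕜 𝕜 E, HasFPowerSeriesOnBall (deriv f) q x r ∧
      ∀ n, q.coeff n = (n + 1) • p.coeff (n + 1) :=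
  ⟨_, (ContinuousLinearMap.apply 𝕜 E (1 : 𝕜)).comp_hasFPowerSeriesOnBall h.fderiv,
    p.derivSeries_coeff_one⟩

theorem hasSum_coeff_mul_pow {𝕜 : Type*} [NontriviallyNormedField 𝕜] {f : 𝕜 → 𝕜}
    {p : FormalMultilinearSeries 𝕜 𝕜 𝕜} {r : ENNReal} (h : HasFPowerSeriesOnBall f p 0 r) {z : 𝕜}
    (hz : z ∈ Metric.eball 0 r) : HasSum (fun n => p.coeff n * z ^ n) (f z) := by
  simpa only [FormalMultilinearSeries.apply_eq_pow_smul_coeff, smul_eq_mul, mul_comm, zero_add]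
    using h.hasSum hz

theorem hasSum_mul_pow_of_hasSum_succ {R : Type*} [CommRing R] [TopologicalSpace R]
    [IsTopologicalRing R] {q : ℕ → R} {z s : R} (h0 : q 0 = 0)
    (h : HasSum (fun n => q (n + 1) * z ^ n) s) : HasSum (fun n => q n * z ^ n) (z * s) := by
  have hshift := h.mul_left z
  simp only [mul_left_comm z, ← pow_succ'] at hshift
  simpa [h0] using (hasSum_nat_add_iff (f := fun n => q n * z ^ n) 1).1 hshift

/-- The left-hand side of the hypergeometric differential equation. -/
noncomputable def hypOp (a b c : ℂ) (f : ℂ → ℂ) (z : ℂ) : ℂ :=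
  z * (1 - z) * deriv (deriv f) z + (c - (a + b + 1) * z) * deriv f z - a * b * f z

/-- `f` is an analytic solution on `U` of the hypergeometric differential equation with parameters
`a`, `b`, `c`. -/
structure IsHypergeometricSolutionOn (a b c : ℂ) (f : ℂ → ℂ) (U : Set ℂ) : Prop where
  analyticOnNhd : AnalyticOnNhd ℂ f U
  hypOp_eq_zero : ∀ z ∈ U, hypOp a b c f z = 0

variable {a b c : ℂ}

theorem IsHypergeometricSolutionOn.mono {f : ℂ → ℂ} {U V : Set ℂ}
    (h : IsHypergeometricSolutionOn a b c f V) (hUV : U ⊆ V) :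
    IsHypergeometricSolutionOn a b c f U :=
  ⟨h.analyticOnNhd.mono hUV, fun z hz => h.hypOp_eq_zero z (hUV hz)⟩

theorem hasSum_hypOp {f : ℂ → ℂ} {p : FormalMultilinearSeries ℂ ℂ ℂ}
    {r : ENNReal} (h : HasFPowerSeriesOnBall f p 0 r) (a b c : ℂ) {z : ℂ}
    (hz : z ∈ Metric.eball 0 r) :
    HasSum (fun n : ℕ => ((n + 1) * (c + n) * p.coeff (n + 1) - (a + n) * (b + n) * p.coeff n)
      * z ^ n) (hypOp a b c f z) := by
  obtain ⟨q, hq, hq_coeff⟩ := exists_hasFPowerSeriesOnBall_deriv h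
  obtain ⟨s, hs, hs_coeff⟩ := exists_hasFPowerSeriesOnBall_deriv hq
  have sum_f := hasSum_coeff_mul_pow h hz
  have sum_f' := hasSum_coeff_mul_pow hq hz
  have sum_f'' := hasSum_coeff_mul_pow hs hz
  simp only [hs_coeff, hq_coeff, nsmul_eq_mul] at sum_f' sum_f''
  push_cast at sum_f' sum_f''
  have sum_zf' : HasSum (fun n : ℕ => (n * p.coeff n) * z ^ n) (z * deriv f z) :=
    hasSum_mul_pow_of_hasSum_succ (by simp) (by simpa using sum_f')
  have sum_zf'' : HasSum (fun n : ℕ => (n * (n + 1) * p.coeff (n + 1)) * z ^ n)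
      (z * deriv (deriv f) z) := by
    refine hasSum_mul_pow_of_hasSum_succ (q := fun n : ℕ => n * (n + 1) * p.coeff (n + 1))
      (by simp) ?_
    simpa [mul_assoc, add_assoc] using sum_f''
  have sum_zzf'' : HasSum (fun n : ℕ => (n * (n - 1) * p.coeff n) * z ^ n)
      (z * (z * deriv (deriv f) z)) := by
    refine hasSum_mul_pow_of_hasSum_succ (q := fun n : ℕ => n * (n - 1) * p.coeff n) (by simp) ?_
    simpa [mul_comm] using sum_zf''
  have hop : hypOp a b c f z = z * deriv (deriv f) z - z * (z * deriv (deriv f) z) +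
      c * deriv f z - (a + b + 1) * (z * deriv f z) - a * b * f z := by
    rw [hypOp]
    ring
  rw [hop]
  refine ((((sum_zf''.sub sum_zzf'').add (sum_f'.mul_left c)).sub
    (sum_zf'.mul_left (a + b + 1))).sub (sum_f.mul_left (a * b))).congr_fun fun n => ?_
  ring

theorem coeff_ordinaryHypergeometricSeries (a b c : ℂ) :
    (ordinaryHypergeometricSeries ℂ a b c).coeff = ordinaryHypergeometricCoefficient a b c := by
  funext n
  simp [ordinaryHypergeometricSeries]

theorem isHypergeometricSolutionOn_ordinaryHypergeometric (hc : ∀ k : ℕ, c ≠ -k) :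
    IsHypergeometricSolutionOn a b c (ordinaryHypergeometric a b c) (Metric.ball 0 1) := by
  refine ⟨analyticOnNhd_ordinaryHypergeometric a b c, fun z hz => ?_⟩
  rw [← Metric.eball_ofReal, ENNReal.ofReal_one] at hz
  refine (hasSum_hypOp (hasFPowerSeriesOnBall_ordinaryHypergeometric a b c) a b c hz).unique ?_
  convert hasSum_zero with n
  rw [coeff_ordinaryHypergeometricSeries, ordinaryHypergeometricCoefficient_succ_mul (hc n),
    sub_self, zero_mul]

theorem eventuallyEq_mul_ordinaryHypergeometric (hc : ∀ k : ℕ, c ≠ -k) {f : ℂ → ℂ} {U : Set ℂ}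
    (hU : U ∈ 𝓝 0) (hf : IsHypergeometricSolutionOn a b c f U) :
    f =ᶠ[𝓝 0] fun z => f 0 * ordinaryHypergeometric a b c z := by
  obtain ⟨p, r, hp⟩ := hf.analyticOnNhd 0 (mem_of_mem_nhds hU)
  have hball : ∀ᶠ z in 𝓝 (0 : ℂ), z ∈ Metric.eball (0 : ℂ) r := Metric.eball_mem_nhds _ hp.r_pos
  set d : ℕ → ℂ := fun n =>
    (n + 1) * (c + n) * p.coeff (n + 1) - (a + n) * (b + n) * p.coeff n with hd
  have hzero : HasFPowerSeriesAt (0 : ℂ → ℂ) (FormalMultilinearSeries.ofScalars ℂ d) 0 := by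
    rw [hasFPowerSeriesAt_iff]
    filter_upwards [hU, hball] with z hzU hzr
    simpa [hd, mul_comm, hf.hypOp_eq_zero z hzU] using hasSum_hypOp hp a b c hzr
  have hrec : ∀ n : ℕ, (n + 1) * (c + n) * p.coeff (n + 1) = (a + n) * (b + n) * p.coeff n :=
    fun n => sub_eq_zero.1 <| congrFun
      ((FormalMultilinearSeries.ofScalars_series_eq_zero ℂ).1 hzero.eq_zero) n
  have hcoeff : ∀ n, p.coeff n = f 0 * ordinaryHypergeometricCoefficient a b c n := by
    intro n
    induction n with
    | zero => rw [ordinaryHypergeometricCoefficient_zero, mul_one]; exact hp.coeff_zero _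
    | succ n ih =>
      have hcn : c + n ≠ 0 := mt eq_neg_of_add_eq_zero_left (hc n)
      refine mul_left_cancel₀ (mul_ne_zero n.cast_add_one_ne_zero hcn) ?_
      rw [hrec, ih, mul_left_comm, mul_left_comm _ (f 0),
        ordinaryHypergeometricCoefficient_succ_mul (hc n)]
  filter_upwards [hball] with z hz
  rw [← (hasSum_coeff_mul_pow hp hz).tsum_eq, ordinaryHypergeometric_eq_tsum_coefficient,
    ← tsum_mul_left]
  simp only [hcoeff, mul_assoc]

theorem deriv_deriv_mul_comp {u w m n H : ℂ → ℂ} {m' n' : ℂ} {U V : Set ℂ} (hU : IsOpen U)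
    (hu : ∀ z ∈ U, HasDerivAt u (u z * m z) z) (hw : ∀ z ∈ U, HasDerivAt w (n z) z)
    (hH : AnalyticOnNhd ℂ H V) (hUV : Set.MapsTo w U V) {z : ℂ} (hz : z ∈ U)
    (hm : HasDerivAt m m' z) (hn : HasDerivAt n n' z) :
    deriv (fun z => u z * H (w z)) z = u z * (m z * H (w z) + n z * deriv H (w z)) ∧
    deriv (deriv fun z => u z * H (w z)) z = u z * ((m z ^ 2 + m') * H (w z) +
      (2 * m z * n z + n') * deriv H (w z) + n z ^ 2 * deriv (deriv H) (w z)) := by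
  have hHw : ∀ z ∈ U, HasDerivAt (fun z => H (w z)) (deriv H (w z) * n z) z := fun z hz =>
    (hH _ (hUV hz)).differentiableAt.hasDerivAt.comp z (hw z hz)
  have hHw' : HasDerivAt (fun z => deriv H (w z)) (deriv (deriv H) (w z) * n z) z :=
    (hH _ (hUV hz)).deriv.differentiableAt.hasDerivAt.comp z (hw z hz)
  have hderiv : ∀ z ∈ U, deriv (fun z => u z * H (w z)) z =
      u z * (m z * H (w z) + n z * deriv H (w z)) := fun z hz => by
    rw [((hu z hz).fun_mul (hHw z hz)).deriv]
    ring
  refine ⟨hderiv z hz, ?_⟩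
  rw [(Set.EqOn.eventuallyEq_of_mem hderiv (hU.mem_nhds hz)).deriv_eq,
    ((hu z hz).fun_mul ((hm.fun_mul (hHw z hz)).fun_add (hn.fun_mul hHw'))).deriv]
  ring

-- Substituting `u * (H ∘ w)` turns the operator with parameters `a`, `b`, `c` into `u * κ` times
-- the operator with parameters `a'`, `b'`, `c'`; the three identities compare the coefficients of
-- `H''`, `H'` and `H`.
theorem IsHypergeometricSolutionOn.mul_comp {a' b' c' : ℂ} {u w m n m' n' κ H : ℂ → ℂ}
    {U V : Set ℂ} (hH : IsHypergeometricSolutionOn a' b' c' H V) (hU : IsOpen U)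
    (hUV : Set.MapsTo w U V)
    (hu : ∀ z ∈ U, HasDerivAt u (u z * m z) z) (hw : ∀ z ∈ U, HasDerivAt w (n z) z)
    (hm : ∀ z ∈ U, HasDerivAt m (m' z) z) (hn : ∀ z ∈ U, HasDerivAt n (n' z) z)
    (coeff₂ : ∀ z ∈ U, z * (1 - z) * n z ^ 2 = κ z * (w z * (1 - w z)))
    (coeff₁ : ∀ z ∈ U, z * (1 - z) * (2 * m z * n z + n' z) + (c - (a + b + 1) * z) * n z =
      κ z * (c' - (a' + b' + 1) * w z))
    (coeff₀ : ∀ z ∈ U, z * (1 - z) * (m z ^ 2 + m' z) + (c - (a + b + 1) * z) * m z - a * b =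
      -(κ z * (a' * b'))) :
    IsHypergeometricSolutionOn a b c (fun z => u z * H (w z)) U := by
  refine ⟨DifferentiableOn.analyticOnNhd (fun z hz => ?_) hU, fun z hz => ?_⟩
  · exact ((hu z hz).differentiableAt.mul
      ((hH.analyticOnNhd _ (hUV hz)).differentiableAt.comp z
        (hw z hz).differentiableAt)).differentiableWithinAt
  · obtain ⟨hd, hdd⟩ :=
      deriv_deriv_mul_comp hU hu hw hH.analyticOnNhd hUV hz (hm z hz) (hn z hz)
    have hode := hH.hypOp_eq_zero _ (hUV hz)
    rw [hypOp] at hode ⊢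
    rw [hd, hdd]
    linear_combination u z * (κ z * hode + deriv (deriv H) (w z) * coeff₂ z hz +
      deriv H (w z) * coeff₁ z hz + H (w z) * coeff₀ z hz)

/-- The Wronskian determinant `f g' - f' g`. -/
noncomputable def wronskian (f g : ℂ → ℂ) (z : ℂ) : ℂ := f z * deriv g z - deriv f z * g z

namespace IsHypergeometricSolutionOn

variable {f g e₁ e₂ : ℂ → ℂ} {U : Set ℂ}

theorem hasDerivAt_wronskian (hf : IsHypergeometricSolutionOn a b c f U)
    (hg : IsHypergeometricSolutionOn a b c g U) {z : ℂ} (hz : z ∈ U) (h0 : z ≠ 0) (h1 : z ≠ 1) :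
    HasDerivAt (wronskian f g)
      (-(c - (a + b + 1) * z) / (z * (1 - z)) * wronskian f g z) z := by
  have af := hf.analyticOnNhd z hz
  have ag := hg.analyticOnNhd z hz
  have hderiv := (af.differentiableAt.hasDerivAt.mul ag.deriv.differentiableAt.hasDerivAt).sub
    (af.deriv.differentiableAt.hasDerivAt.mul ag.differentiableAt.hasDerivAt)
  refine hderiv.congr_deriv ?_
  have of := hf.hypOp_eq_zero z hz
  have og := hg.hypOp_eq_zero z hz
  have hne : z * (1 - z) ≠ 0 := mul_ne_zero h0 (sub_ne_zero.2 h1.symm)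
  rw [hypOp] at of og
  rw [wronskian, div_mul_eq_mul_div, eq_div_iff hne]
  linear_combination f z * og - g z * of

theorem exists_wronskian_eq_const_mul (hU : IsOpen U) (hU' : IsPreconnected U) (h0 : 0 ∉ U)
    (h1 : 1 ∉ U) (hf : IsHypergeometricSolutionOn a b c f U)
    (hg : IsHypergeometricSolutionOn a b c g U) (he₁ : IsHypergeometricSolutionOn a b c e₁ U)
    (he₂ : IsHypergeometricSolutionOn a b c e₂ U) (hW : ∀ z ∈ U, wronskian e₁ e₂ z ≠ 0) :
    ∃ p : ℂ, ∀ z ∈ U, wronskian f g z = p * wronskian e₁ e₂ z := by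
  have hratio : ∀ z ∈ U, HasDerivAt (wronskian f g / wronskian e₁ e₂) 0 z := by
    intro z hz
    have hz0 := ne_of_mem_of_not_mem hz h0
    have hz1 := ne_of_mem_of_not_mem hz h1
    refine ((hf.hasDerivAt_wronskian hg hz hz0 hz1).div
      (he₁.hasDerivAt_wronskian he₂ hz hz0 hz1) (hW z hz)).congr_deriv ?_
    ring
  obtain ⟨p, hp⟩ := hU.exists_is_const_of_deriv_eq_zero hU'
    (fun z hz => (hratio z hz).differentiableAt.differentiableWithinAt)
    (fun z hz => (hratio z hz).deriv)
  exact ⟨p, fun z hz => (div_eq_iff (hW z hz)).1 (hp z hz)⟩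

theorem exists_eqOn_add_of_wronskian_ne_zero (hU : IsOpen U) (hU' : IsPreconnected U)
    (h0 : 0 ∉ U) (h1 : 1 ∉ U) (hf : IsHypergeometricSolutionOn a b c f U)
    (he₁ : IsHypergeometricSolutionOn a b c e₁ U) (he₂ : IsHypergeometricSolutionOn a b c e₂ U)
    {z₀ : ℂ} (hz₀ : z₀ ∈ U) (hW : wronskian e₁ e₂ z₀ ≠ 0) :
    ∃ p q : ℂ, ∀ z ∈ U, f z = p * e₁ z + q * e₂ z := by
  have hWc := (he₁.hasDerivAt_wronskian he₂ hz₀ (ne_of_mem_of_not_mem hz₀ h0)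
    (ne_of_mem_of_not_mem hz₀ h1)).continuousAt.eventually_ne hW
  obtain ⟨ε, hε, hball⟩ := Metric.eventually_nhds_iff_ball.1 (hWc.and (hU.mem_nhds hz₀))
  have hsub : Metric.ball z₀ ε ⊆ U := fun z hz => (hball z hz).2
  have hconst : ∀ {g h : ℂ → ℂ}, IsHypergeometricSolutionOn a b c g U →
      IsHypergeometricSolutionOn a b c h U →
      ∃ p : ℂ, ∀ z ∈ Metric.ball z₀ ε, wronskian g h z = p * wronskian e₁ e₂ z := fun hg hh =>
    exists_wronskian_eq_const_mul Metric.isOpen_ball (convex_ball z₀ ε).isPreconnected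
      (fun h => h0 (hsub h)) (fun h => h1 (hsub h)) (hg.mono hsub) (hh.mono hsub)
      (he₁.mono hsub) (he₂.mono hsub) fun z hz => (hball z hz).1
  obtain ⟨p, hp⟩ := hconst hf he₂
  obtain ⟨q, hq⟩ := hconst he₁ hf
  refine ⟨p, q, hf.analyticOnNhd.eqOn_of_preconnected_of_eventuallyEq
    ((analyticOnNhd_const.mul he₁.analyticOnNhd).add (analyticOnNhd_const.mul he₂.analyticOnNhd))
    hU' hz₀ ?_⟩
  filter_upwards [Metric.ball_mem_nhds z₀ hε] with z hz
  refine mul_right_cancel₀ (hball z hz).1 ?_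
  have hpz := hp z hz
  have hqz := hq z hz
  simp only [wronskian] at hpz hqz ⊢
  linear_combination e₁ z * hpz + e₂ z * hqz

end IsHypergeometricSolutionOn

end HypergeometricEquation

section CutPlanes

theorem mem_cutPlane_iff {z : ℂ} : z ∈ cutPlane ↔ 1 - z ∈ Complex.slitPlane := by
  rw [Complex.mem_slitPlane_iff, cutPlane, Set.mem_compl_iff, ← not_iff_not, not_not]
  simp only [Complex.sub_re, Complex.one_re, Complex.sub_im, Complex.one_im, not_or, not_lt,
    sub_nonpos, zero_sub, neg_eq_zero, ne_eq, not_not]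
  constructor
  · rintro ⟨x, hx, rfl⟩
    simpa using hx
  · rintro ⟨hre, him⟩
    exact ⟨z.re, hre, Complex.ext rfl (by simp [him])⟩

theorem isOpen_cutPlane : IsOpen cutPlane := by
  rw [show cutPlane = (1 - ·) ⁻¹' Complex.slitPlane from Set.ext fun _ => mem_cutPlane_iff]
  exact Complex.isOpen_slitPlane.preimage (continuous_sub_left 1)

theorem ball_subset_cutPlane : Metric.ball (0 : ℂ) 1 ⊆ cutPlane := fun z hz => by
  rw [mem_cutPlane_iff, sub_eq_add_neg]
  exact Complex.mem_slitPlane_of_norm_lt_one (by simpa using hz)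

theorem zero_mem_cutPlane : (0 : ℂ) ∈ cutPlane :=
  ball_subset_cutPlane (Metric.mem_ball_self one_pos)

/-- The complex plane cut along the real half-line `[0, ∞)`. -/
def posCutPlane : Set ℂ := {z | -z ∈ Complex.slitPlane}

theorem mem_posCutPlane_iff {z : ℂ} : z ∈ posCutPlane ↔ 1 + z ∈ cutPlane := by
  rw [mem_cutPlane_iff, sub_add_cancel_left]
  rfl

theorem mem_posCutPlane_iff_notMem_image {z : ℂ} :
    z ∈ posCutPlane ↔ z ∉ Complex.ofReal '' Set.Ici (0 : ℝ) := by
  rw [mem_posCutPlane_iff, cutPlane, Set.mem_compl_iff, not_iff_not]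
  constructor
  · rintro ⟨x, hx, h⟩
    exact ⟨x - 1, sub_nonneg.2 (Set.mem_Ici.1 hx), by rw [Complex.ofReal_sub, h, Complex.ofReal_one,
      add_sub_cancel_left]⟩
  · rintro ⟨x, hx, rfl⟩
    exact ⟨1 + x, le_add_of_nonneg_right (Set.mem_Ici.1 hx), by simp⟩

theorem isOpen_posCutPlane : IsOpen posCutPlane :=
  Complex.isOpen_slitPlane.preimage continuous_neg

theorem ne_zero_of_mem_posCutPlane {z : ℂ} (hz : z ∈ posCutPlane) : z ≠ 0 :=
  neg_ne_zero.1 (Complex.slitPlane_ne_zero hz)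

theorem posCutPlane_subset_cutPlane : posCutPlane ⊆ cutPlane := fun z hz => by
  rw [mem_posCutPlane_iff_notMem_image] at hz
  rintro ⟨x, hx, rfl⟩
  exact hz ⟨x, zero_le_one.trans (Set.mem_Ici.1 hx), rfl⟩

theorem one_div_mem_cutPlane {z : ℂ} (hz : z ∈ posCutPlane) : 1 / z ∈ cutPlane := by
  rw [mem_posCutPlane_iff_notMem_image] at hz
  rintro ⟨x, hx, h⟩
  refine hz ⟨x⁻¹, inv_nonneg.2 (zero_le_one.trans (Set.mem_Ici.1 hx)), ?_⟩
  rw [Complex.ofReal_inv, h, one_div, inv_inv]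

theorem ofReal_mul_mem_posCutPlane {z : ℂ} (hz : z ∈ posCutPlane) {t : ℝ} (ht : 0 < t) :
    (t : ℂ) * z ∈ posCutPlane := by
  change -(t * z) ∈ Complex.slitPlane
  change -z ∈ Complex.slitPlane at hz
  rw [Complex.mem_slitPlane_iff] at hz ⊢
  simpa [ht, ht.ne', mul_neg_iff, ht.not_gt] using hz

/-- The unit disc cut along the positive reals. -/
def cutDisc : Set ℂ := Metric.ball 0 1 ∩ posCutPlane

theorem isOpen_cutDisc : IsOpen cutDisc := Metric.isOpen_ball.inter isOpen_posCutPlane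

theorem neg_ofReal_mem_cutDisc {x : ℝ} (hx : x ∈ Set.Ioo 0 1) : (-x : ℂ) ∈ cutDisc := by
  refine ⟨by simpa [abs_of_pos hx.1] using hx.2, ?_⟩
  change - -_ ∈ Complex.slitPlane
  rw [neg_neg, Complex.ofReal_mem_slitPlane]
  exact hx.1

theorem neg_half_mem_cutDisc : (-(1 / 2 : ℝ) : ℂ) ∈ cutDisc :=
  neg_ofReal_mem_cutDisc ⟨one_half_pos, one_half_lt_one⟩

theorem starConvex_posCutPlane {x : ℝ} (hx : 0 < x) : StarConvex ℝ (-x : ℂ) posCutPlane :=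
  (Complex.starConvex_ofReal_slitPlane hx).neg

theorem isPreconnected_posCutPlane : IsPreconnected posCutPlane :=
  ((starConvex_posCutPlane one_half_pos).isPathConnected
    neg_half_mem_cutDisc.2).isConnected.isPreconnected

theorem isPreconnected_cutDisc : IsPreconnected cutDisc :=
  ((((convex_ball _ _).starConvex neg_half_mem_cutDisc.1).inter
    (starConvex_posCutPlane one_half_pos)).isPathConnected
    neg_half_mem_cutDisc).isConnected.isPreconnected

open Filter Topology in
theorem closedBall_inter_posCutPlane_subset_closure_cutDisc :
    Metric.closedBall 0 1 ∩ posCutPlane ⊆ closure cutDisc := by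
  rintro z ⟨hz1, hz2⟩
  have ht : Tendsto (fun t : ℝ => (t : ℂ) * z) (𝓝[<] 1) (𝓝 z) := by
    have : ContinuousAt (fun t : ℝ => (t : ℂ) * z) 1 := by fun_prop
    simpa using this.tendsto.mono_left nhdsWithin_le_nhds
  refine mem_closure_of_tendsto ht ?_
  filter_upwards [Ioo_mem_nhdsLT (zero_lt_one (α := ℝ))] with t ht
  refine ⟨?_, ofReal_mul_mem_posCutPlane hz2 ht.1⟩
  rw [mem_ball_zero_iff, norm_mul, Complex.norm_of_nonneg ht.1.le]
  exact (mul_le_of_le_one_right ht.1.le (mem_closedBall_zero_iff.1 hz1)).trans_lt ht.2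

theorem hasDerivAt_neg_cpow (s : ℂ) {z : ℂ} (hz : z ∈ posCutPlane) :
    HasDerivAt (fun z : ℂ => (-z) ^ s) ((-z) ^ s * (s / z)) z := by
  have hz0 := ne_zero_of_mem_posCutPlane hz
  refine ((hasDerivAt_neg z).cpow_const hz).congr_deriv ?_
  rw [Complex.cpow_sub _ _ (neg_ne_zero.2 hz0), Complex.cpow_one]
  field_simp

theorem analyticOnNhd_neg_cpow (s : ℂ) : AnalyticOnNhd ℂ (fun z : ℂ => (-z) ^ s) posCutPlane :=
  DifferentiableOn.analyticOnNhd
    (fun _ hz => (hasDerivAt_neg_cpow s hz).differentiableAt.differentiableWithinAt)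
    isOpen_posCutPlane

end CutPlanes

section SolutionsByChangeOfVariable

open Topology

variable {a b c : ℂ}

theorem IsHypergeometricSolutionOn.isGaussContinuation {f : ℂ → ℂ} (hc : ∀ k : ℕ, c ≠ -k)
    (hf : IsHypergeometricSolutionOn a b c f cutPlane) (h0 : f 0 = 1) :
    IsGaussContinuation a b c f := by
  refine ⟨hf.analyticOnNhd, ?_⟩
  refine (hf.analyticOnNhd.mono ball_subset_cutPlane).eqOn_of_preconnected_of_eventuallyEq
    (analyticOnNhd_ordinaryHypergeometric a b c) (convex_ball _ _).isPreconnected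
    (Metric.mem_ball_self one_pos) ?_
  simpa [h0] using eventuallyEq_mul_ordinaryHypergeometric hc
    (isOpen_cutPlane.mem_nhds zero_mem_cutPlane) hf

theorem hasDerivAt_const_div_self (s : ℂ) {z : ℂ} (hz : z ≠ 0) :
    HasDerivAt (fun z => s / z) (-s / z ^ 2) z := by
  simpa using (hasDerivAt_const z s).fun_div (hasDerivAt_id' z) hz

theorem IsHypergeometricSolutionOn.neg_cpow_mul_comp_one_div {H : ℂ → ℂ}
    (hH : IsHypergeometricSolutionOn a (a - c + 1) (a - b + 1) H cutPlane) :
    IsHypergeometricSolutionOn a b c (fun z => (-z) ^ (-a) * H (1 / z)) posCutPlane := by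
  have hne := fun z (hz : z ∈ posCutPlane) => ne_zero_of_mem_posCutPlane hz
  refine hH.mul_comp (m := fun z => -a / z) (n := fun z => -1 / z ^ 2)
    (m' := fun z => a / z ^ 2) (n' := fun z => 2 / z ^ 3) (κ := fun z => -1 / z)
    isOpen_posCutPlane (fun z hz => one_div_mem_cutPlane hz)
    (fun z hz => hasDerivAt_neg_cpow (-a) hz)
    (fun z hz => hasDerivAt_const_div_self 1 (hne z hz))
    (fun z hz => by simpa using hasDerivAt_const_div_self (-a) (hne z hz))
    (fun z hz => ?_) (fun z hz => ?_) (fun z hz => ?_) (fun z hz => ?_)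
  all_goals have hz0 := hne z hz
  · refine ((hasDerivAt_const z (-1)).fun_div (hasDerivAt_pow 2 z)
      (pow_ne_zero 2 hz0)).congr_deriv ?_
    field_simp
    norm_num [mul_comm]
  all_goals
    field_simp
    ring

theorem IsHypergeometricSolutionOn.neg_cpow_mul {H : ℂ → ℂ} {V : Set ℂ} (hV : IsOpen V)
    (hH : IsHypergeometricSolutionOn (a - c + 1) (b - c + 1) (2 - c) H V) :
    IsHypergeometricSolutionOn a b c (fun z => (-z) ^ (1 - c) * H z) (V ∩ posCutPlane) := by
  have hne := fun z (hz : z ∈ V ∩ posCutPlane) => ne_zero_of_mem_posCutPlane hz.2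
  refine hH.mul_comp (m := fun z => (1 - c) / z) (n := fun _ => 1)
    (m' := fun z => -(1 - c) / z ^ 2) (n' := fun _ => 0) (κ := fun _ => 1)
    (hV.inter isOpen_posCutPlane) (fun z hz => hz.1)
    (fun z hz => hasDerivAt_neg_cpow _ hz.2) (fun z _ => hasDerivAt_id' z)
    (fun z hz => hasDerivAt_const_div_self _ (hne z hz)) (fun z _ => hasDerivAt_const z 1)
    (fun z _ => ?_) (fun z hz => ?_) (fun z hz => ?_)
  · ring
  all_goals
    have hz0 := hne z hz
    field_simp
    ring

end SolutionsByChangeOfVariable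

section QuadraticTransformation

theorem one_add_ne_zero_of_re_pos {r : ℂ} (h : 0 < r.re) : 1 + r ≠ 0 :=
  Complex.ne_zero_of_re_pos (by simpa using add_pos one_pos h)

theorem norm_one_sub_div_one_add_lt_one {r : ℂ} (h : 0 < r.re) : ‖(1 - r) / (1 + r)‖ < 1 := by
  rw [norm_div, div_lt_one (norm_pos_iff.2 (one_add_ne_zero_of_re_pos h)),
    ← sq_lt_sq₀ (norm_nonneg _) (norm_nonneg _), Complex.sq_norm, Complex.sq_norm,
    Complex.normSq_apply, Complex.normSq_apply]
  simp only [Complex.sub_re, Complex.sub_im, Complex.add_re, Complex.add_im, Complex.one_re,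
    Complex.one_im]
  linarith

/-- The square root of `1 - z`, with positive real part on the plane cut along `[1, ∞)`. -/
noncomputable def sqrtOneSub (z : ℂ) : ℂ := Complex.sqrt (1 - z)

theorem sqrtOneSub_sq (z : ℂ) : sqrtOneSub z ^ 2 = 1 - z :=
  Complex.cpow_nat_inv_pow _ two_ne_zero

theorem re_sqrtOneSub_pos {z : ℂ} (hz : z ∈ cutPlane) : 0 < (sqrtOneSub z).re := by
  rw [sqrtOneSub, Complex.sqrt, Complex.cpow_inv_two_re, Real.sqrt_pos]
  rcases Complex.mem_slitPlane_iff.1 (mem_cutPlane_iff.1 hz) with hre | him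
  · positivity
  · linarith [(abs_lt.1 (Complex.abs_re_lt_norm.2 him)).1]

theorem sqrtOneSub_ne_zero {z : ℂ} (hz : z ∈ cutPlane) : sqrtOneSub z ≠ 0 :=
  Complex.ne_zero_of_re_pos (re_sqrtOneSub_pos hz)

theorem one_add_sqrtOneSub_ne_zero {z : ℂ} (hz : z ∈ cutPlane) : 1 + sqrtOneSub z ≠ 0 :=
  one_add_ne_zero_of_re_pos (re_sqrtOneSub_pos hz)

theorem hasDerivAt_sqrtOneSub {z : ℂ} (hz : z ∈ cutPlane) :
    HasDerivAt sqrtOneSub (-1 / (2 * sqrtOneSub z)) z := by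
  have hz' := mem_cutPlane_iff.1 hz
  have hsqrt := (Complex.hasDerivAt_sqrt hz').comp_const_sub 1 z
  refine hsqrt.congr_deriv ?_
  have hr := sqrtOneSub_ne_zero hz
  have hpow : (1 - z) ^ (-1 / 2 : ℂ) = (sqrtOneSub z)⁻¹ := by
    rw [sqrtOneSub, Complex.sqrt, ← Complex.cpow_neg]
    norm_num
  rw [hpow]
  field_simp

theorem hasDerivAt_half_one_add_sqrtOneSub_cpow (s : ℂ) {z : ℂ} (hz : z ∈ cutPlane) :
    HasDerivAt (fun z => ((1 + sqrtOneSub z) / 2) ^ s)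
      (((1 + sqrtOneSub z) / 2) ^ s * (-s / (2 * sqrtOneSub z * (1 + sqrtOneSub z)))) z := by
  have hr := sqrtOneSub_ne_zero hz
  have hr1 := one_add_sqrtOneSub_ne_zero hz
  have hslit : (1 + sqrtOneSub z) / 2 ∈ Complex.slitPlane := by
    left
    simpa using add_pos one_pos (re_sqrtOneSub_pos hz)
  refine (((hasDerivAt_sqrtOneSub hz).const_add 1).div_const 2).cpow_const hslit
    |>.congr_deriv ?_
  rw [Complex.cpow_sub _ _ (Complex.slitPlane_ne_zero hslit), Complex.cpow_one]
  field_simp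

theorem hasDerivAt_one_sub_div_one_add_sqrtOneSub {z : ℂ} (hz : z ∈ cutPlane) :
    HasDerivAt (fun z => (1 - sqrtOneSub z) / (1 + sqrtOneSub z))
      (1 / (sqrtOneSub z * (1 + sqrtOneSub z) ^ 2)) z := by
  have hr := sqrtOneSub_ne_zero hz
  have hr1 := one_add_sqrtOneSub_ne_zero hz
  have h := hasDerivAt_sqrtOneSub hz
  refine ((h.const_sub 1).fun_div (h.const_add 1) hr1).congr_deriv ?_
  field_simp
  ring

/-- The continuation of `₂F₁(a, a + 1/2; c; z)` to the plane cut along `[1, ∞)` obtained from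
Gauss's quadratic transformation: the Cayley transform maps the half-plane of the values of
`√(1 - z)` to the unit disc, where the Gauss series converges. -/
noncomputable def gaussQuad (a c z : ℂ) : ℂ :=
  ((1 + sqrtOneSub z) / 2) ^ (-(2 * a)) *
    ordinaryHypergeometric (2 * a) (2 * a - c + 1) c ((1 - sqrtOneSub z) / (1 + sqrtOneSub z))

theorem gaussQuad_zero (a c : ℂ) : gaussQuad a c 0 = 1 := by
  simp [gaussQuad, sqrtOneSub]

theorem isHypergeometricSolutionOn_gaussQuad (a : ℂ) {c : ℂ} (hc : ∀ k : ℕ, c ≠ -k) :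
    IsHypergeometricSolutionOn a (a + 1 / 2) c (gaussQuad a c) cutPlane := by
  refine (isHypergeometricSolutionOn_ordinaryHypergeometric hc).mul_comp
    (m := fun z => a / (sqrtOneSub z * (1 + sqrtOneSub z)))
    (n := fun z => 1 / (sqrtOneSub z * (1 + sqrtOneSub z) ^ 2))
    (m' := fun z => a * (1 + 2 * sqrtOneSub z) / (2 * sqrtOneSub z ^ 3 * (1 + sqrtOneSub z) ^ 2))
    (n' := fun z => (1 + 3 * sqrtOneSub z) / (2 * sqrtOneSub z ^ 3 * (1 + sqrtOneSub z) ^ 3))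
    (κ := fun z => 1 / (2 * sqrtOneSub z * (1 + sqrtOneSub z)))
    isOpen_cutPlane
    (fun z hz => by simpa using norm_one_sub_div_one_add_lt_one (re_sqrtOneSub_pos hz))
    (fun z hz => ?_) (fun z hz => hasDerivAt_one_sub_div_one_add_sqrtOneSub hz)
    (fun z hz => ?_) (fun z hz => ?_) (fun z hz => ?_) (fun z hz => ?_) (fun z hz => ?_)
  all_goals
    have hr : sqrtOneSub z ≠ 0 := sqrtOneSub_ne_zero hz
    have hr1 : 1 + sqrtOneSub z ≠ 0 := one_add_sqrtOneSub_ne_zero hz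
    have hd := hasDerivAt_sqrtOneSub hz
    have hz_eq : z = 1 - sqrtOneSub z ^ 2 := by rw [sqrtOneSub_sq, sub_sub_cancel]
  · refine (hasDerivAt_half_one_add_sqrtOneSub_cpow _ hz).congr_deriv ?_
    field_simp
  · refine ((hasDerivAt_const z a).fun_div (hd.fun_mul (hd.const_add 1))
      (mul_ne_zero hr hr1)).congr_deriv ?_
    field_simp
    ring
  · refine ((hasDerivAt_const z 1).fun_div (hd.fun_mul ((hd.const_add 1).fun_pow 2))
      (mul_ne_zero hr (pow_ne_zero 2 hr1))).congr_deriv ?_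
    field_simp
    ring
  all_goals
    clear hd
    generalize sqrtOneSub z = r at *
    subst hz_eq
    field_simp
    ring

theorem isGaussContinuation_gaussQuad (a : ℂ) {c : ℂ} (hc : ∀ k : ℕ, c ≠ -k) :
    IsGaussContinuation a (a + 1 / 2) c (gaussQuad a c) :=
  (isHypergeometricSolutionOn_gaussQuad a hc).isGaussContinuation hc (gaussQuad_zero a c)

end QuadraticTransformation

section FrobeniusBasis

open Filter Topology

variable {a b c : ℂ} {f g : ℂ → ℂ}

theorem exists_mem_cutDisc_wronskian_neg_cpow_mul_ne_zero {s : ℂ} (hs : s ≠ 0)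
    (hf : AnalyticAt ℂ f 0) (hg : AnalyticAt ℂ g 0) (hf0 : f 0 ≠ 0) (hg0 : g 0 ≠ 0) :
    ∃ z ∈ cutDisc, wronskian f (fun z => (-z) ^ s * g z) z ≠ 0 := by
  -- `z` times the Wronskian is `(-z) ^ s * V z`, and `V` does not vanish at the origin.
  set V : ℂ → ℂ := fun z => s * f z * g z + z * wronskian f g z with hV
  have hVc : ContinuousAt V 0 := by
    have := hf.continuousAt
    have := hg.continuousAt
    have := hf.deriv.continuousAt
    have := hg.deriv.continuousAt
    simp only [hV, wronskian]
    fun_prop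
  have hV0 : V 0 ≠ 0 := by simp [hV, hs, hf0, hg0]
  have ht : Tendsto (fun x : ℝ => (-x : ℂ)) (𝓝[>] 0) (𝓝 0) := by
    have : ContinuousAt (fun x : ℝ => (-x : ℂ)) 0 := by fun_prop
    simpa using this.tendsto.mono_left nhdsWithin_le_nhds
  obtain ⟨x, ⟨hVx, hgx⟩, hx⟩ :=
    ((ht.eventually ((hVc.eventually_ne hV0).and hg.eventually_analyticAt)).and
      (Ioo_mem_nhdsGT zero_lt_one)).exists
  have hz := neg_ofReal_mem_cutDisc hx
  generalize (-x : ℂ) = z at *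
  refine ⟨z, hz, fun h => hVx ?_⟩
  have hz0 := ne_zero_of_mem_posCutPlane hz.2
  have hpow : (-z) ^ s ≠ 0 := by simp [Complex.cpow_eq_zero_iff, hz0]
  have hderiv := ((hasDerivAt_neg_cpow s hz.2).fun_mul hgx.differentiableAt.hasDerivAt).deriv
  simp only [wronskian, hderiv] at h
  refine (mul_eq_zero.1 ?_).resolve_left hpow
  simp only [hV, wronskian]
  field_simp at h
  linear_combination h

theorem IsHypergeometricSolutionOn.exists_eqOn_cutDisc (hc : ∀ n : ℤ, c ≠ n)
    (hf : IsHypergeometricSolutionOn a b c f cutDisc) :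
    ∃ p q : ℂ, ∀ z ∈ cutDisc, f z = p * ordinaryHypergeometric a b c z +
      q * ((-z) ^ (1 - c) *
        ordinaryHypergeometric (a - c + 1) (b - c + 1) (2 - c) z) := by
  have hc₁ : ∀ k : ℕ, c ≠ -k := fun k => by exact_mod_cast hc (-k)
  have hc₂ : ∀ k : ℕ, 2 - c ≠ -k := fun k h => hc (2 + k) <| by
    push_cast
    linear_combination -h
  obtain ⟨z₀, hz₀, hW⟩ := exists_mem_cutDisc_wronskian_neg_cpow_mul_ne_zero
    (sub_ne_zero.2 (by exact_mod_cast (hc 1).symm : (1 : ℂ) ≠ c))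
    (analyticOnNhd_ordinaryHypergeometric a b c 0 (Metric.mem_ball_self one_pos))
    (analyticOnNhd_ordinaryHypergeometric (a - c + 1) (b - c + 1) (2 - c) 0
      (Metric.mem_ball_self one_pos)) (by simp) (by simp)
  refine hf.exists_eqOn_add_of_wronskian_ne_zero isOpen_cutDisc isPreconnected_cutDisc
    (fun h => ne_zero_of_mem_posCutPlane h.2 rfl) (fun h => by simpa using h.1)
    ((isHypergeometricSolutionOn_ordinaryHypergeometric hc₁).mono Set.inter_subset_left) ?_ hz₀ hW
  exact (isHypergeometricSolutionOn_ordinaryHypergeometric hc₂).neg_cpow_mul Metric.isOpen_ball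

end FrobeniusBasis

section SolutionAtInfinity

variable {a b : ℂ}

/-- The solution of the hypergeometric equation with parameters `a`, `b`, `1 / 2` that behaves like
`(-z) ^ (-a)` at infinity. -/
noncomputable def solInfinity (a b z : ℂ) : ℂ := (-z) ^ (-a) * gaussQuad a (a - b + 1) (1 / z)

theorem isHypergeometricSolutionOn_solInfinity (h : ∀ k : ℕ, a - b + 1 ≠ -k) :
    IsHypergeometricSolutionOn a b (1 / 2) (solInfinity a b) posCutPlane := by
  refine IsHypergeometricSolutionOn.neg_cpow_mul_comp_one_div ?_
  rw [show a - 1 / 2 + 1 = a + 1 / 2 by ring]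
  exact isHypergeometricSolutionOn_gaussQuad a h

/-- `solInfinity a b` is the combination of the two solutions at the origin with the coefficients
`p` and `q`. -/
def IsConnection (a b p q : ℂ) : Prop :=
  ∀ z ∈ cutDisc, solInfinity a b z = p * ordinaryHypergeometric a b (1 / 2) z +
    q * ((-z) ^ (1 / 2 : ℂ) * ordinaryHypergeometric (a + 1 / 2) (b + 1 / 2) (3 / 2) z)

theorem exists_isConnection (h : ∀ k : ℕ, a - b + 1 ≠ -k) : ∃ p q, IsConnection a b p q := by
  have half_ne : ∀ n : ℤ, (1 / 2 : ℂ) ≠ n := fun n hn => by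
    have : (1 : ℂ) = 2 * n := by linear_combination 2 * hn
    norm_cast at this
    omega
  obtain ⟨p, q, hpq⟩ := ((isHypergeometricSolutionOn_solInfinity h).mono
    Set.inter_subset_right).exists_eqOn_cutDisc half_ne
  refine ⟨p, q, fun z hz => (hpq z hz).trans ?_⟩
  rw [show a - 1 / 2 + 1 = a + 1 / 2 by ring, show b - 1 / 2 + 1 = b + 1 / 2 by ring]
  norm_num

end SolutionAtInfinity

section BoundaryValues

variable {a b c p q : ℂ}

theorem IsGaussContinuation.eqOn_closedBall {f : ℂ → ℂ}
    (hf : IsGaussContinuation a b c f) (hc : ∀ k : ℕ, c ≠ -k) (h : (a + b - c).re < 0) :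
    Set.EqOn f (ordinaryHypergeometric a b c) (Metric.closedBall 0 1 ∩ cutPlane) := by
  refine hf.2.of_subset_closure (hf.1.continuousOn.mono Set.inter_subset_right)
    ((continuousOn_ordinaryHypergeometric_closedBall hc h).mono Set.inter_subset_left)
    (Set.subset_inter Metric.ball_subset_closedBall ball_subset_cutPlane) ?_
  rw [closure_ball _ one_ne_zero]
  exact Set.inter_subset_left

theorem neg_exp_mem_closedBall (τ : ℝ) :
    -Complex.exp (τ * Complex.I) ∈ Metric.closedBall (0 : ℂ) 1 := by
  simp [Complex.norm_exp_ofReal_mul_I]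

theorem neg_exp_mem_posCutPlane {τ : ℝ} (hτ : τ ∈ Set.Ioo (-Real.pi) Real.pi) :
    -Complex.exp (τ * Complex.I) ∈ posCutPlane := by
  change - -_ ∈ Complex.slitPlane
  rw [neg_neg, Complex.mem_slitPlane_iff_arg, Complex.arg_exp_mul_I,
    (toIocMod_eq_self _).2 ⟨hτ.1, by linarith [hτ.2]⟩]
  exact ⟨hτ.2.ne, Complex.exp_ne_zero _⟩

theorem exp_mul_I_cpow {τ : ℝ} (hτ : τ ∈ Set.Ioc (-Real.pi) Real.pi) (s : ℂ) :
    Complex.exp (τ * Complex.I) ^ s = Complex.exp (τ * Complex.I * s) := by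
  rw [Complex.cpow_def_of_ne_zero (Complex.exp_ne_zero _),
    Complex.log_exp (by simpa using hτ.1) (by simpa using hτ.2)]

theorem re_neg_of_eq_sub_half {s t : ℂ} (hs : s.re < 1 / 2) (h : t = s - 1 / 2) : t.re < 0 := by
  rw [h]
  simpa using hs

theorem IsConnection.eqOn_closedBall (hp : IsConnection a b p q) (hc : ∀ k : ℕ, a - b + 1 ≠ -k)
    (hab : (a + b).re < 1 / 2) :
    Set.EqOn (solInfinity a b) (fun z => p * ordinaryHypergeometric a b (1 / 2) z +
        q * ((-z) ^ (1 / 2 : ℂ) * ordinaryHypergeometric (a + 1 / 2) (b + 1 / 2) (3 / 2) z))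
      (Metric.closedBall 0 1 ∩ posCutPlane) := by
  have cE₁ := continuousOn_ordinaryHypergeometric_closedBall
    (ne_neg_natCast_of_re_pos (by norm_num)) (re_neg_of_eq_sub_half hab (t := a + b - 1 / 2) rfl)
  have cE₂ := continuousOn_ordinaryHypergeometric_closedBall
    (ne_neg_natCast_of_re_pos (by norm_num))
    (re_neg_of_eq_sub_half hab (t := a + 1 / 2 + (b + 1 / 2) - 3 / 2) (by ring))
  exact Set.EqOn.of_subset_closure hp
    ((isHypergeometricSolutionOn_solInfinity hc).analyticOnNhd.continuousOn.mono
      Set.inter_subset_right)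
    ((continuousOn_const.mul (cE₁.mono Set.inter_subset_left)).add
      (continuousOn_const.mul (((analyticOnNhd_neg_cpow _).continuousOn.mono
        Set.inter_subset_right).mul (cE₂.mono Set.inter_subset_left))))
    (Set.inter_subset_inter_left _ Metric.ball_subset_closedBall)
    closedBall_inter_posCutPlane_subset_closure_cutDisc

theorem solInfinity_neg_exp (hc : ∀ k : ℕ, a - b + 1 ≠ -k) (hab : (a + b).re < 1 / 2) {τ : ℝ}
    (hτ : τ ∈ Set.Ioo (-Real.pi) Real.pi) :
    solInfinity a b (-Complex.exp (τ * Complex.I)) =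
      Complex.exp (τ * Complex.I * -a) * ordinaryHypergeometric a (a + 1 / 2) (a - b + 1)
        (-Complex.exp ((-τ : ℝ) * Complex.I)) := by
  have hinv : 1 / -Complex.exp (τ * Complex.I) = -Complex.exp ((-τ : ℝ) * Complex.I) := by
    rw [Complex.ofReal_neg, neg_mul, Complex.exp_neg]
    field_simp
  rw [solInfinity, neg_neg, exp_mul_I_cpow (Set.Ioo_subset_Ioc_self hτ), hinv,
    (isGaussContinuation_gaussQuad a hc).eqOn_closedBall hc
      (re_neg_of_eq_sub_half hab (by ring)) ⟨neg_exp_mem_closedBall _, ?_⟩]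
  exact hinv ▸ one_div_mem_cutPlane (neg_exp_mem_posCutPlane hτ)

-- The endpoints `τ = ±π` give the two boundary values at `z = 1`.
theorem IsConnection.eq_on_circle (hp : IsConnection a b p q) (hc : ∀ k : ℕ, a - b + 1 ≠ -k)
    (hab : (a + b).re < 1 / 2) {τ : ℝ} (hτ : τ ∈ Set.Icc (-Real.pi) Real.pi) :
    Complex.exp (τ * Complex.I * -a) * ordinaryHypergeometric a (a + 1 / 2) (a - b + 1)
        (-Complex.exp ((-τ : ℝ) * Complex.I)) =
      p * ordinaryHypergeometric a b (1 / 2) (-Complex.exp (τ * Complex.I)) +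
        q * (Complex.exp (τ * Complex.I * (1 / 2)) *
          ordinaryHypergeometric (a + 1 / 2) (b + 1 / 2) (3 / 2)
            (-Complex.exp (τ * Complex.I))) := by
  have cF := continuousOn_ordinaryHypergeometric_closedBall hc
    (re_neg_of_eq_sub_half hab (t := a + (a + 1 / 2) - (a - b + 1)) (by ring))
  have cE₁ := continuousOn_ordinaryHypergeometric_closedBall
    (ne_neg_natCast_of_re_pos (by norm_num)) (re_neg_of_eq_sub_half hab (t := a + b - 1 / 2) rfl)
  have cE₂ := continuousOn_ordinaryHypergeometric_closedBall
    (ne_neg_natCast_of_re_pos (by norm_num))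
    (re_neg_of_eq_sub_half hab (t := a + 1 / 2 + (b + 1 / 2) - 3 / 2) (by ring))
  have cexp : ∀ s : ℂ, Continuous fun τ : ℝ => Complex.exp (τ * Complex.I * s) := by fun_prop
  rw [← closure_Ioo (by linarith [Real.pi_pos] : -Real.pi ≠ Real.pi)] at hτ
  refine Set.EqOn.closure (fun τ hτ => ?_)
    ((cexp _).mul (cF.comp_continuous (by fun_prop) fun τ => neg_exp_mem_closedBall (-τ)))
    (((cE₁.comp_continuous (by fun_prop) neg_exp_mem_closedBall).const_mul p).add
      (((cexp _).mul (cE₂.comp_continuous (by fun_prop) neg_exp_mem_closedBall)).const_mul q)) hτ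
  simp only [Pi.mul_apply, Pi.add_apply, Function.comp_apply]
  rw [← solInfinity_neg_exp hc hab hτ,
    hp.eqOn_closedBall hc hab ⟨neg_exp_mem_closedBall τ, neg_exp_mem_posCutPlane hτ⟩]
  beta_reduce
  rw [neg_neg, exp_mul_I_cpow (Set.Ioo_subset_Ioc_self hτ)]

end BoundaryValues

section ConnectionCoefficients

open Filter

variable {a b p q : ℂ}

theorem IsConnection.eq_at_one (hp : IsConnection a b p q) (hc : ∀ k : ℕ, a - b + 1 ≠ -k)
    (hab : (a + b).re < 1 / 2) :
    Complex.cos (Real.pi * a) * ordinaryHypergeometric a (a + 1 / 2) (a - b + 1) (1 : ℂ) =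
        p * ordinaryHypergeometric a b (1 / 2) (1 : ℂ) ∧
      -Complex.sin (Real.pi * a) * ordinaryHypergeometric a (a + 1 / 2) (a - b + 1) (1 : ℂ) =
        q * ordinaryHypergeometric (a + 1 / 2) (b + 1 / 2) (3 / 2) (1 : ℂ) := by
  have hle : -Real.pi ≤ Real.pi := by linarith [Real.pi_pos]
  have hplus := hp.eq_on_circle hc hab ⟨hle, le_rfl⟩
  have hminus := hp.eq_on_circle hc hab ⟨le_rfl, hle⟩
  have neg_exp_pi : -Complex.exp (Real.pi * Complex.I) = 1 := by rw [Complex.exp_pi_mul_I, neg_neg]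
  have neg_exp_neg_pi : -Complex.exp ((-Real.pi : ℝ) * Complex.I) = 1 := by
    rw [Complex.ofReal_neg, neg_mul, Complex.exp_neg, Complex.exp_pi_mul_I, inv_neg_one, neg_neg]
  have exp_half : Complex.exp (Real.pi * Complex.I * (1 / 2)) = Complex.I := by
    rw [show Real.pi * Complex.I * (1 / 2) = Real.pi / 2 * Complex.I by ring,
      Complex.exp_pi_div_two_mul_I]
  have exp_neg_half : Complex.exp ((-Real.pi : ℝ) * Complex.I * (1 / 2)) = -Complex.I := by
    rw [Complex.ofReal_neg, neg_mul, neg_mul, Complex.exp_neg, exp_half, Complex.inv_I]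
  have exp_neg_mul : Complex.exp (Real.pi * Complex.I * -a) =
      Complex.cos (Real.pi * a) - Complex.sin (Real.pi * a) * Complex.I := by
    rw [show Real.pi * Complex.I * -a = -(Real.pi * a) * Complex.I by ring, Complex.exp_mul_I,
      Complex.cos_neg, Complex.sin_neg, neg_mul, sub_eq_add_neg]
  have exp_neg_mul_neg : Complex.exp ((-Real.pi : ℝ) * Complex.I * -a) =
      Complex.cos (Real.pi * a) + Complex.sin (Real.pi * a) * Complex.I := by
    rw [Complex.ofReal_neg, show -Real.pi * Complex.I * -a = Real.pi * a * Complex.I by ring,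
      Complex.exp_mul_I]
  rw [neg_exp_neg_pi, neg_exp_pi, exp_half, exp_neg_mul] at hplus
  rw [neg_neg, neg_exp_neg_pi, neg_exp_pi, exp_neg_half, exp_neg_mul_neg] at hminus
  refine ⟨by linear_combination (hplus + hminus) / 2, mul_left_cancel₀ Complex.I_ne_zero ?_⟩
  linear_combination (hplus - hminus) / 2

theorem inv_Gamma_mul_inv_Gamma_one_sub (z : ℂ) :
    (Complex.Gamma z)⁻¹ * (Complex.Gamma (1 - z))⁻¹ = Complex.sin (Real.pi * z) / Real.pi := by
  rw [← mul_inv, Complex.Gamma_mul_Gamma_one_sub, inv_div]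

theorem inv_Gamma_add_half_mul_inv_Gamma_half_sub (z : ℂ) :
    (Complex.Gamma (z + 1 / 2))⁻¹ * (Complex.Gamma (1 / 2 - z))⁻¹ =
      Complex.cos (Real.pi * z) / Real.pi := by
  have h := inv_Gamma_mul_inv_Gamma_one_sub (z + 1 / 2)
  rwa [show 1 - (z + 1 / 2) = 1 / 2 - z by ring,
    show Real.pi * (z + 1 / 2) = Real.pi * z + Real.pi / 2 by ring,
    Complex.sin_add_pi_div_two] at h

theorem Gamma_half_eq_sqrt_pi : Complex.Gamma (1 / 2) = (√Real.pi : ℝ) := by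
  rw [← Real.Gamma_one_half_eq, ← Complex.Gamma_ofReal, Complex.ofReal_div, Complex.ofReal_one,
    Complex.ofReal_ofNat]

theorem Gamma_three_halves_eq_sqrt_pi_div_two : Complex.Gamma (3 / 2) = (√Real.pi : ℝ) / 2 := by
  rw [show (3 / 2 : ℂ) = 1 / 2 + 1 by norm_num, Complex.Gamma_add_one _ (by norm_num),
    Gamma_half_eq_sqrt_pi, one_div_mul_eq_div]

theorem sqrt_pi_mul_self : ((√Real.pi : ℝ) : ℂ) * (√Real.pi : ℝ) = Real.pi := by
  rw [← Complex.ofReal_mul, Real.mul_self_sqrt Real.pi_pos.le]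

theorem sqrt_pi_ne_zero : ((√Real.pi : ℝ) : ℂ) ≠ 0 := by
  exact_mod_cast (Real.sqrt_pos.2 Real.pi_pos).ne'

/-- The coefficient of `₂F₁(a, b; 1/2; z)` in the solution `solInfinity a b`. -/
noncomputable def connP (a b : ℂ) : ℂ :=
  (√Real.pi : ℝ) * Complex.Gamma (a - b + 1) * (Complex.Gamma (a + 1 / 2))⁻¹ *
    (Complex.Gamma (1 - b))⁻¹

/-- The coefficient of `(-z) ^ (1 / 2) ₂F₁(a + 1/2, b + 1/2; 3/2; z)` in the solution
`solInfinity a b`. -/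
noncomputable def connQ (a b : ℂ) : ℂ :=
  -2 * (√Real.pi : ℝ) * Complex.Gamma (a - b + 1) * (Complex.Gamma a)⁻¹ *
    (Complex.Gamma (1 / 2 - b))⁻¹

theorem Gamma_ofReal_sub_ne_zero {x : ℝ} {s : ℂ} (h : s.re < x) :
    Complex.Gamma (x - s) ≠ 0 :=
  Complex.Gamma_ne_zero_of_re_pos (by simpa using h)

theorem IsConnection.eq_connP (hp : IsConnection a b p q) (hc : ∀ k : ℕ, a - b + 1 ≠ -k)
    (ha : a.re < 1 / 2) (hb : b.re < 1 / 2) (hab : (a + b).re < 1 / 2) : p = connP a b := by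
  have hcos := (hp.eq_at_one hc hab).1
  rw [ordinaryHypergeometric_one hc (re_neg_of_eq_sub_half hab (by ring)),
    ordinaryHypergeometric_one (ne_neg_natCast_of_re_pos (by norm_num))
      (re_neg_of_eq_sub_half hab rfl),
    show a - b + 1 - a - (a + 1 / 2) = 1 / 2 - (a + b) by ring,
    show a - b + 1 - a = 1 - b by ring, show a - b + 1 - (a + 1 / 2) = 1 / 2 - b by ring,
    sub_sub, Gamma_half_eq_sqrt_pi,
    ← mul_div_cancel_right₀ (Complex.cos _) (Complex.ofReal_ne_zero.2 Real.pi_ne_zero),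
    mul_div_right_comm, ← inv_Gamma_add_half_mul_inv_Gamma_half_sub, ← sqrt_pi_mul_self] at hcos
  have half_ne {s : ℂ} (hs : s.re < 1 / 2) : Complex.Gamma (1 / 2 - s) ≠ 0 := by
    simpa using Gamma_ofReal_sub_ne_zero hs
  refine mul_right_cancel₀ (mul_ne_zero (mul_ne_zero (mul_ne_zero sqrt_pi_ne_zero (half_ne hab))
    (inv_ne_zero (half_ne ha))) (inv_ne_zero (half_ne hb))) ?_
  rw [connP]
  linear_combination -hcos

theorem IsConnection.eq_connQ (hp : IsConnection a b p q) (hc : ∀ k : ℕ, a - b + 1 ≠ -k)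
    (ha : a.re < 1) (hb : b.re < 1) (hab : (a + b).re < 1 / 2) : q = connQ a b := by
  have hsin := (hp.eq_at_one hc hab).2
  rw [ordinaryHypergeometric_one hc (re_neg_of_eq_sub_half hab (by ring)),
    ordinaryHypergeometric_one (ne_neg_natCast_of_re_pos (by norm_num))
      (re_neg_of_eq_sub_half hab (by ring)),
    show a - b + 1 - a - (a + 1 / 2) = 1 / 2 - (a + b) by ring,
    show a - b + 1 - a = 1 - b by ring, show a - b + 1 - (a + 1 / 2) = 1 / 2 - b by ring,
    show 3 / 2 - (a + 1 / 2) - (b + 1 / 2) = 1 / 2 - (a + b) by ring,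
    show 3 / 2 - (a + 1 / 2) = 1 - a by ring, show 3 / 2 - (b + 1 / 2) = 1 - b by ring,
    Gamma_three_halves_eq_sqrt_pi_div_two,
    ← mul_div_cancel_right₀ (Complex.sin _) (Complex.ofReal_ne_zero.2 Real.pi_ne_zero),
    mul_div_right_comm, ← inv_Gamma_mul_inv_Gamma_one_sub, ← sqrt_pi_mul_self] at hsin
  have one_ne {s : ℂ} (hs : s.re < 1) : Complex.Gamma (1 - s) ≠ 0 := by
    simpa using Gamma_ofReal_sub_ne_zero hs
  have hΓab : Complex.Gamma (1 / 2 - (a + b)) ≠ 0 := by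
    simpa using Gamma_ofReal_sub_ne_zero hab
  refine mul_right_cancel₀ (mul_ne_zero (mul_ne_zero (mul_ne_zero
    (div_ne_zero sqrt_pi_ne_zero two_ne_zero) hΓab) (inv_ne_zero (one_ne ha)))
    (inv_ne_zero (one_ne hb))) ?_
  rw [connQ]
  linear_combination -hsin

theorem differentiable_inv_Gamma_comp {f : ℂ → ℂ} (hf : Differentiable ℂ f) :
    Differentiable ℂ fun t => (Complex.Gamma (f t))⁻¹ :=
  Complex.differentiable_one_div_Gamma.comp hf

theorem differentiable_connP_add (a b : ℂ) : Differentiable ℂ fun t => connP (a + t) (b + t) := by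
  simp only [connP, add_sub_add_right_eq_sub]
  exact ((differentiable_inv_Gamma_comp (by fun_prop)).const_mul _).mul
    (differentiable_inv_Gamma_comp (by fun_prop))

theorem differentiable_connQ_add (a b : ℂ) : Differentiable ℂ fun t => connQ (a + t) (b + t) := by
  simp only [connQ, add_sub_add_right_eq_sub]
  exact ((differentiable_inv_Gamma_comp (by fun_prop)).const_mul _).mul
    (differentiable_inv_Gamma_comp (by fun_prop))

theorem half_one_add_sqrtOneSub_ne_zero {z : ℂ} (hz : z ∈ cutPlane) :
    (1 + sqrtOneSub z) / 2 ≠ 0 :=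
  div_ne_zero (one_add_sqrtOneSub_ne_zero hz) two_ne_zero

theorem differentiable_solInfinity_add (a b : ℂ) {z : ℂ} (hz : z ∈ posCutPlane) :
    Differentiable ℂ fun t => solInfinity (a + t) (b + t) z := by
  have hz' := one_div_mem_cutPlane hz
  simp only [solInfinity, gaussQuad, add_sub_add_right_eq_sub]
  refine Differentiable.mul (fun t => ?_) (Differentiable.mul (fun t => ?_) ?_)
  · exact DifferentiableAt.const_cpow (by fun_prop)
      (Or.inl (neg_ne_zero.2 (ne_zero_of_mem_posCutPlane hz)))
  · exact DifferentiableAt.const_cpow (by fun_prop)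
      (Or.inl (half_one_add_sqrtOneSub_ne_zero hz'))
  · exact differentiable_ordinaryHypergeometric_comp (by fun_prop) (by fun_prop) _
      (norm_one_sub_div_one_add_lt_one (re_sqrtOneSub_pos hz'))

-- The coefficients are known when `a` and `b` lie in the left half-plane; both sides are entire in
-- the parameter of the shift `(a, b) ↦ (a + t, b + t)`.
theorem isConnection_connP_connQ (hc : ∀ k : ℕ, a - b + 1 ≠ -k) :
    IsConnection a b (connP a b) (connQ a b) := by
  intro z hz
  have hz₁ : ‖z‖ < 1 := by simpa using hz.1
  have hl := differentiable_solInfinity_add a b hz.2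
  have hr : Differentiable ℂ fun t => connP (a + t) (b + t) *
      ordinaryHypergeometric (a + t) (b + t) (1 / 2) z + connQ (a + t) (b + t) *
        ((-z) ^ (1 / 2 : ℂ) * ordinaryHypergeometric (a + t + 1 / 2) (b + t + 1 / 2) (3 / 2) z) :=
    ((differentiable_connP_add a b).mul (differentiable_ordinaryHypergeometric_comp (by fun_prop)
      (by fun_prop) _ hz₁)).add ((differentiable_connQ_add a b).mul
        ((differentiable_ordinaryHypergeometric_comp (by fun_prop) (by fun_prop) _
          hz₁).const_mul _))
  have hnhds : {t : ℂ | (a + t).re < 0} ∩ {t : ℂ | (b + t).re < 0} ∈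
      nhds (-(|a.re| + |b.re| + 1 : ℝ) : ℂ) := by
    refine ((isOpen_lt (by fun_prop) continuous_const).inter
      (isOpen_lt (by fun_prop) continuous_const)).mem_nhds ⟨?_, ?_⟩
    all_goals
      simp only [Set.mem_ofPred_eq, Complex.add_re, Complex.neg_re, Complex.ofReal_re]
      linarith [le_abs_self a.re, le_abs_self b.re, abs_nonneg a.re, abs_nonneg b.re]
  have key := (hl.differentiableOn.analyticOnNhd isOpen_univ).eq_of_eventuallyEq
    (hr.differentiableOn.analyticOnNhd isOpen_univ) (mem_of_superset hnhds fun t ⟨ha, hb⟩ => by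
      have hct : ∀ k : ℕ, a + t - (b + t) + 1 ≠ -k := by simpa using hc
      simp only [Set.mem_ofPred_eq] at ha hb
      have hab : (a + t + (b + t)).re < 1 / 2 := by
        rw [Complex.add_re]
        linarith
      obtain ⟨p, q, hpq⟩ := exists_isConnection hct
      obtain rfl := hpq.eq_connP hct (by linarith) (by linarith) hab
      obtain rfl := hpq.eq_connQ hct (by linarith) (by linarith) hab
      exact hpq z hz)
  simpa using congrFun key 0

end ConnectionCoefficients

section HypergeometricFunction

variable {a b c : ℂ}

theorem IsGaussContinuation.eqOn_hyp2F1 {f : ℂ → ℂ} (hf : IsGaussContinuation a b c f) :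
    Set.EqOn (hyp2F1 a b c) f cutPlane := by
  intro z hz
  have h : z ∈ cutPlane ∧ ∃ f, IsGaussContinuation a b c f := ⟨hz, f, hf⟩
  rw [hyp2F1, dif_pos h]
  exact h.2.choose_spec.eqOn hf hz

theorem IsGaussContinuation.hyp2F1 {f : ℂ → ℂ} (hf : IsGaussContinuation a b c f) :
    IsGaussContinuation a b c (hyp2F1 a b c) :=
  ⟨hf.1.congr isOpen_cutPlane hf.eqOn_hyp2F1.symm,
    (hf.eqOn_hyp2F1.mono ball_subset_cutPlane).trans hf.2⟩

theorem continuousOn_hyp2F1 (hf : IsGaussContinuation a b c (hyp2F1 a b c))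
    (hc : ∀ k : ℕ, c ≠ -k) (h : (a + b - c).re < 0) :
    ContinuousOn (hyp2F1 a b c) (Metric.closedBall 0 1) := by
  refine (continuousOn_ordinaryHypergeometric_closedBall hc h).congr fun z hz => ?_
  by_cases hzc : z ∈ cutPlane
  · exact hf.eqOn_closedBall hc h ⟨hz, hzc⟩
  · rw [hyp2F1, dif_neg fun h => hzc h.1]

theorem mem_ball_or_mem_posCutPlane {z : ℂ} (hz : z ∈ cutPlane) :
    z ∈ Metric.ball (0 : ℂ) 1 ∨ z ∈ posCutPlane := by
  rw [mem_posCutPlane_iff_notMem_image, or_iff_not_imp_right, not_not]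
  rintro ⟨x, hx, rfl⟩
  rw [mem_ball_zero_iff, Complex.norm_of_nonneg hx]
  exact not_le.1 fun h => hz ⟨x, h, rfl⟩

open Classical in
theorem exists_isGaussContinuation_of_eqOn_cutDisc {g : ℂ → ℂ}
    (hg : AnalyticOnNhd ℂ g posCutPlane) (h : Set.EqOn g (ordinaryHypergeometric a b c) cutDisc) :
    ∃ f, IsGaussContinuation a b c f := by
  let f := (Metric.ball (0 : ℂ) 1).piecewise (ordinaryHypergeometric a b c) g
  have hball : Set.EqOn f (ordinaryHypergeometric a b c) (Metric.ball 0 1) :=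
    Set.piecewise_eqOn _ _ _
  have hcut : Set.EqOn f g posCutPlane := fun z hz => by
    by_cases hb : z ∈ Metric.ball (0 : ℂ) 1
    · exact (hball hb).trans (h ⟨hb, hz⟩).symm
    · exact Set.piecewise_eqOn_compl _ _ _ hb
  refine ⟨f, fun z hz => ?_, hball⟩
  rcases mem_ball_or_mem_posCutPlane hz with hz | hz
  · exact (analyticOnNhd_ordinaryHypergeometric a b c).congr Metric.isOpen_ball hball.symm z hz
  · exact hg.congr isOpen_posCutPlane hcut.symm z hz

end HypergeometricFunction

section ConnectionFormula

variable {a b : ℂ}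

theorem neg_ne_intCast {s : ℂ} (hs : ∀ n : ℤ, s ≠ n) (n : ℤ) : -s ≠ n := fun h =>
  hs (-n) (by rw [Int.cast_neg, ← h, neg_neg])

theorem add_one_ne_neg_natCast {s : ℂ} (hs : ∀ n : ℤ, s ≠ n) (k : ℕ) : s + 1 ≠ -k := fun h =>
  hs (-k - 1) (by push_cast; linear_combination h)

theorem Gamma_add_one_mul_Gamma_neg_add_one {s : ℂ} (hs : ∀ n : ℤ, s ≠ n) :
    Complex.Gamma (s + 1) * Complex.Gamma (-s + 1) * Complex.sin (Real.pi * s) = s * Real.pi := by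
  rw [Complex.Gamma_add_one _ (by simpa using hs 0), neg_add_eq_sub, mul_assoc s,
    Complex.Gamma_mul_Gamma_one_sub, mul_assoc,
    div_mul_cancel₀ _ (sin_pi_mul_ne_zero fun ⟨n, hn⟩ => hs n hn.symm)]

theorem connP_mul_connQ_swap (a b : ℂ) :
    connP a b * connQ b a = -2 * Complex.Gamma (a - b + 1) * Complex.Gamma (b - a + 1) *
      (Complex.cos (Real.pi * a) * Complex.sin (Real.pi * b)) / Real.pi := by
  have hcos := inv_Gamma_add_half_mul_inv_Gamma_half_sub a
  have hsin := inv_Gamma_mul_inv_Gamma_one_sub b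
  have hπ : (Real.pi : ℂ) ≠ 0 := Complex.ofReal_ne_zero.2 Real.pi_ne_zero
  rw [connP, connQ]
  calc _ = -2 * Complex.Gamma (a - b + 1) * Complex.Gamma (b - a + 1) *
        (((√Real.pi : ℝ) : ℂ) * (√Real.pi : ℝ) *
          ((Complex.Gamma (a + 1 / 2))⁻¹ * (Complex.Gamma (1 / 2 - a))⁻¹) *
          ((Complex.Gamma b)⁻¹ * (Complex.Gamma (1 - b))⁻¹)) := by ring
    _ = _ := by
      rw [hcos, hsin, sqrt_pi_mul_self]
      field_simp

theorem connP_mul_connQ_sub_connP_mul_connQ (h : ∀ n : ℤ, a - b ≠ n) :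
    connP a b * connQ b a - connP b a * connQ a b = 2 * (a - b) := by
  have hΓ := Gamma_add_one_mul_Gamma_neg_add_one h
  have hπ : (Real.pi : ℂ) ≠ 0 := Complex.ofReal_ne_zero.2 Real.pi_ne_zero
  rw [neg_sub, mul_sub, Complex.sin_sub] at hΓ
  rw [connP_mul_connQ_swap, connP_mul_connQ_swap, ← sub_div, div_eq_iff hπ]
  linear_combination 2 * hΓ

theorem isConnection_of_sub_ne_intCast (h : ∀ n : ℤ, a - b ≠ n) :
    IsConnection a b (connP a b) (connQ a b) :=
  isConnection_connP_connQ (add_one_ne_neg_natCast h)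

theorem sub_swap_ne_intCast (h : ∀ n : ℤ, a - b ≠ n) (n : ℤ) : b - a ≠ n := by
  simpa using neg_ne_intCast h n

theorem IsConnection.swap {p q : ℂ} (h : IsConnection b a p q) {z : ℂ} (hz : z ∈ cutDisc) :
    solInfinity b a z = p * ordinaryHypergeometric a b (1 / 2) z +
      q * ((-z) ^ (1 / 2 : ℂ) *
        ordinaryHypergeometric (a + 1 / 2) (b + 1 / 2) (3 / 2) z) := by
  rw [h z hz, ordinaryHypergeometric_comm b, ordinaryHypergeometric_comm (b + 1 / 2)]

theorem analyticOnNhd_solInfinity (h : ∀ n : ℤ, a - b ≠ n) :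
    AnalyticOnNhd ℂ (solInfinity a b) posCutPlane :=
  (isHypergeometricSolutionOn_solInfinity (add_one_ne_neg_natCast h)).analyticOnNhd

-- The next two continuations are read off by inverting the connection matrix, whose determinant is
-- `2 (a - b)`.
theorem isGaussContinuation_hyp2F1_half (h : ∀ n : ℤ, a - b ≠ n) :
    IsGaussContinuation a b (1 / 2) (hyp2F1 a b (1 / 2)) := by
  have h' := sub_swap_ne_intCast h
  have h₀ : 2 * (a - b) ≠ 0 := mul_ne_zero two_ne_zero (by simpa using h 0)
  have hg : AnalyticOnNhd ℂ (fun z => (2 * (a - b))⁻¹ *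
      (connQ b a * solInfinity a b z - connQ a b * solInfinity b a z)) posCutPlane :=
    analyticOnNhd_const.mul ((analyticOnNhd_const.mul (analyticOnNhd_solInfinity h)).sub
      (analyticOnNhd_const.mul (analyticOnNhd_solInfinity h')))
  obtain ⟨f, hf⟩ := exists_isGaussContinuation_of_eqOn_cutDisc
    (a := a) (b := b) (c := 1 / 2) hg fun z hz => by
    rw [isConnection_of_sub_ne_intCast h z hz, (isConnection_of_sub_ne_intCast h').swap hz,
      inv_mul_eq_iff_eq_mul₀ h₀, ← connP_mul_connQ_sub_connP_mul_connQ h]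
    ring
  exact hf.hyp2F1

theorem isGaussContinuation_hyp2F1_three_halves (h : ∀ n : ℤ, a - b ≠ n) :
    IsGaussContinuation (a + 1 / 2) (b + 1 / 2) (3 / 2)
      (hyp2F1 (a + 1 / 2) (b + 1 / 2) (3 / 2)) := by
  have h' := sub_swap_ne_intCast h
  have h₀ : 2 * (a - b) ≠ 0 := mul_ne_zero two_ne_zero (by simpa using h 0)
  have hg : AnalyticOnNhd ℂ (fun z => (2 * (a - b))⁻¹ * ((-z) ^ (-(1 / 2) : ℂ) *
      (connP a b * solInfinity b a z - connP b a * solInfinity a b z))) posCutPlane :=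
    analyticOnNhd_const.mul ((analyticOnNhd_neg_cpow _).mul
      ((analyticOnNhd_const.mul (analyticOnNhd_solInfinity h')).sub
        (analyticOnNhd_const.mul (analyticOnNhd_solInfinity h))))
  obtain ⟨f, hf⟩ := exists_isGaussContinuation_of_eqOn_cutDisc
    (a := a + 1 / 2) (b := b + 1 / 2) (c := 3 / 2) hg fun z hz => by
    have hpow : (-z) ^ (1 / 2 : ℂ) ≠ 0 := by
      simp [Complex.cpow_eq_zero_iff, ne_zero_of_mem_posCutPlane hz.2]
    rw [isConnection_of_sub_ne_intCast h z hz, (isConnection_of_sub_ne_intCast h').swap hz,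
      inv_mul_eq_iff_eq_mul₀ h₀, Complex.cpow_neg, inv_mul_eq_iff_eq_mul₀ hpow,
      ← connP_mul_connQ_sub_connP_mul_connQ h]
    ring
  exact hf.hyp2F1

theorem isGaussContinuation_hyp2F1_add_half (h : ∀ n : ℤ, a - b ≠ n) :
    IsGaussContinuation a (a + 1 / 2) (a - b + 1) (hyp2F1 a (a + 1 / 2) (a - b + 1)) :=
  (isGaussContinuation_gaussQuad a (add_one_ne_neg_natCast h)).hyp2F1

theorem neg_cpow_mul_hyp2F1_one_div (h : ∀ n : ℤ, a - b ≠ n) {z : ℂ} (hz : z ∈ posCutPlane) :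
    (-z) ^ (-a) * hyp2F1 a (a + 1 / 2) (a - b + 1) (1 / z) = connP a b * hyp2F1 a b (1 / 2) z +
      connQ a b * ((-z) ^ (1 / 2 : ℂ) * hyp2F1 (a + 1 / 2) (b + 1 / 2) (3 / 2) z) := by
  have hE₁ := isGaussContinuation_hyp2F1_half h
  have hE₂ := isGaussContinuation_hyp2F1_three_halves h
  rw [(isGaussContinuation_hyp2F1_add_half h).eqOn
    (isGaussContinuation_gaussQuad a (add_one_ne_neg_natCast h)) (one_div_mem_cutPlane hz)]
  refine (analyticOnNhd_solInfinity h).eqOn_of_preconnected_of_eventuallyEq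
    ((analyticOnNhd_const.mul (hE₁.1.mono posCutPlane_subset_cutPlane)).add
      (analyticOnNhd_const.mul ((analyticOnNhd_neg_cpow _).mul
        (hE₂.1.mono posCutPlane_subset_cutPlane))))
    isPreconnected_posCutPlane neg_half_mem_cutDisc.2 ?_ hz
  filter_upwards [isOpen_cutDisc.mem_nhds neg_half_mem_cutDisc] with y hy
  rw [isConnection_of_sub_ne_intCast h y hy, ← hE₁.2 hy.1, ← hE₂.2 hy.1]
  rfl

end ConnectionFormula

section Arguments

variable {z : ℂ} {θ : ℝ}

theorem log_neg_of_arg (hz : z ≠ 0) (hθ : θ ∈ Set.Ioo 0 (2 * Real.pi))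
    (h : z = ‖z‖ * Complex.exp (θ * Complex.I)) :
    Complex.log (-z) = Real.log ‖z‖ + (θ - Real.pi : ℝ) * Complex.I := by
  have hneg : -z = ‖z‖ * Complex.exp ((θ - Real.pi : ℝ) * Complex.I) := by
    rw [Complex.ofReal_sub, sub_mul, Complex.exp_sub, Complex.exp_pi_mul_I, div_neg, div_one,
      mul_neg, ← h]
  rw [hneg, Complex.log_ofReal_mul (norm_pos_iff.2 hz) (Complex.exp_ne_zero _), Complex.log_exp]
  all_goals
    rw [Complex.im_ofReal_mul, Complex.I_im, mul_one]
    linarith [hθ.1, hθ.2]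

theorem mem_posCutPlane_of_arg (hz : z ≠ 0) (hθ : θ ∈ Set.Ioo 0 (2 * Real.pi))
    (h : z = ‖z‖ * Complex.exp (θ * Complex.I)) : z ∈ posCutPlane := by
  refine Complex.mem_slitPlane_iff_arg.2 ⟨?_, neg_ne_zero.2 hz⟩
  rw [← Complex.log_im, log_neg_of_arg hz hθ h]
  simp only [Complex.add_im, Complex.ofReal_im, Complex.im_ofReal_mul, Complex.I_im, mul_one,
    zero_add]
  linarith [hθ.2]

theorem exists_arg_mem_Ioo (hz : z ∈ posCutPlane) :
    ∃ θ ∈ Set.Ioo 0 (2 * Real.pi), z = ‖z‖ * Complex.exp (θ * Complex.I) := by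
  have hlt := (Complex.arg_le_pi (-z)).lt_of_ne (Complex.mem_slitPlane_iff_arg.1 hz).1
  refine ⟨(-z).arg + Real.pi, ⟨by linarith [Complex.neg_pi_lt_arg (-z)], by linarith⟩, ?_⟩
  rw [Complex.ofReal_add, add_mul, Complex.exp_add, Complex.exp_pi_mul_I, mul_neg_one, mul_neg,
    ← norm_neg z, Complex.norm_mul_exp_arg_mul_I, neg_neg]

theorem powArg_eq_neg_cpow (hz : z ≠ 0) (hθ : θ ∈ Set.Ioo 0 (2 * Real.pi))
    (h : z = ‖z‖ * Complex.exp (θ * Complex.I)) (s : ℂ) :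
    powArg z θ s = (-z) ^ s * Complex.exp (Real.pi * Complex.I * s) := by
  rw [powArg, Complex.cpow_def_of_ne_zero (neg_ne_zero.2 hz), log_neg_of_arg hz hθ h,
    ← Complex.exp_add, Complex.ofReal_sub]
  ring_nf

theorem powArg_conj (z : ℂ) (θ : ℝ) (s : ℂ) :
    powArg (starRingEnd ℂ z) (-θ) s = starRingEnd ℂ (powArg z θ (starRingEnd ℂ s)) := by
  simp [powArg, ← Complex.exp_conj]

theorem powArg_conj_eq_neg_cpow (hz : z ≠ 0) (hθ : θ ∈ Set.Ioo 0 (2 * Real.pi))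
    (h : z = ‖z‖ * Complex.exp (θ * Complex.I)) (s : ℂ) :
    powArg (starRingEnd ℂ z) (-θ) s =
      (-starRingEnd ℂ z) ^ s * Complex.exp (-(Real.pi * Complex.I * s)) := by
  have hz' := (Complex.mem_slitPlane_iff_arg.1 (mem_posCutPlane_of_arg hz hθ h)).1
  rw [powArg_conj, powArg_eq_neg_cpow hz hθ h, map_mul, ← Complex.conj_cpow _ _ hz', map_neg,
    ← Complex.exp_conj]
  simp

theorem powArg_add_two_pi_mul_int (z : ℂ) (θ : ℝ) (k : ℤ) (s : ℂ) :
    powArg z (θ + 2 * Real.pi * k) s =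
      powArg z θ s * Complex.exp (2 * Real.pi * k * Complex.I * s) := by
  rw [powArg, powArg, ← Complex.exp_add]
  push_cast
  ring_nf

theorem conj_mem_posCutPlane (hz : z ∈ posCutPlane) : starRingEnd ℂ z ∈ posCutPlane := by
  change -starRingEnd ℂ z ∈ Complex.slitPlane
  rw [← map_neg]
  exact Complex.mem_slitPlane_iff.2 (by simpa using Complex.mem_slitPlane_iff.1 hz)

theorem conj_mem_cutPlane (hz : z ∈ cutPlane) : starRingEnd ℂ z ∈ cutPlane := by
  rw [mem_cutPlane_iff, Complex.mem_slitPlane_iff] at hz ⊢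
  simpa using hz

theorem neg_cpow_half_mul_conj (hz : z ∈ posCutPlane) :
    (-z) ^ (1 / 2 : ℂ) * (-starRingEnd ℂ z) ^ (1 / 2 : ℂ) = ‖z‖ := by
  have hhalf : starRingEnd ℂ (1 / 2 : ℂ) = 1 / 2 := by
    rw [map_div₀, map_one, Complex.conj_ofNat]
  have hsq : ((-z) ^ (1 / 2 : ℂ)) ^ 2 = -z := by
    rw [one_div]
    exact Complex.cpow_nat_inv_pow _ two_ne_zero
  rw [← map_neg, Complex.conj_cpow _ _ (Complex.mem_slitPlane_iff_arg.1 hz).1, hhalf,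
    Complex.mul_conj, Complex.normSq_eq_norm_sq, ← norm_pow, hsq, norm_neg]

end Arguments

section HypergeometricFamilies

theorem hyp2F1_comm (a b c : ℂ) : hyp2F1 a b c = hyp2F1 b a c := by
  have h : IsGaussContinuation a b c = IsGaussContinuation b a c := by
    funext f
    rw [IsGaussContinuation, IsGaussContinuation, ordinaryHypergeometric_comm]
  funext z
  by_cases hz : z ∈ cutPlane ∧ ∃ f, IsGaussContinuation a b c f
  · have hz' := h ▸ hz
    rw [hyp2F1, hyp2F1, dif_pos hz, dif_pos hz']
    exact hz.2.choose_spec.eqOn ((congrFun h _).mpr hz'.2.choose_spec) hz.1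
  · have hz' := hz
    rw [h] at hz'
    rw [hyp2F1, hyp2F1, dif_neg hz, dif_neg hz', ordinaryHypergeometric_comm]

theorem hypG2_eq_hypG1 (ρ ν z : ℂ) (θ : ℝ) : hypG2 ρ ν z θ = hypG1 ρ (-ν) z θ := by
  simp only [hypG2, hypG1, hypF2, hypF1, sub_eq_add_neg]

theorem hypE1_neg (ρ ν : ℂ) : hypE1 ρ (-ν) = hypE1 ρ ν := by
  funext z
  rw [hypE1, hypE1, hyp2F1_comm, sub_neg_eq_add, ← sub_eq_add_neg]

theorem hypE2_neg (ρ ν : ℂ) : hypE2 ρ (-ν) = hypE2 ρ ν := by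
  funext z
  rw [hypE2, hypE2, hyp2F1_comm, sub_neg_eq_add, ← sub_eq_add_neg]

theorem hypE2_eq (ρ ν : ℂ) :
    hypE2 ρ ν = hyp2F1 ((ρ + ν) / 2 + 1 / 2) ((ρ - ν) / 2 + 1 / 2) (3 / 2) := by
  funext z
  rw [hypE2, add_div (ρ + ν), add_div (ρ - ν)]

theorem hypF1_eq (ρ ν : ℂ) :
    hypF1 ρ ν = hyp2F1 ((ρ + ν) / 2) ((ρ + ν) / 2 + 1 / 2) ((ρ + ν) / 2 - (ρ - ν) / 2 + 1) := by
  funext z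
  rw [hypF1]
  ring_nf

variable {ν : ℂ}

theorem half_add_sub_half_sub_ne_intCast (hν : ∀ n : ℤ, ν ≠ n) (ρ : ℂ) (n : ℤ) :
    (ρ + ν) / 2 - (ρ - ν) / 2 ≠ n := by
  convert hν n using 1
  ring

theorem isGaussContinuation_hypE1 (hν : ∀ n : ℤ, ν ≠ n) (ρ : ℂ) :
    IsGaussContinuation ((ρ + ν) / 2) ((ρ - ν) / 2) (1 / 2) (hypE1 ρ ν) :=
  isGaussContinuation_hyp2F1_half (half_add_sub_half_sub_ne_intCast hν ρ)

theorem isGaussContinuation_hypE2 (hν : ∀ n : ℤ, ν ≠ n) (ρ : ℂ) :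
    IsGaussContinuation ((ρ + ν) / 2 + 1 / 2) ((ρ - ν) / 2 + 1 / 2) (3 / 2) (hypE2 ρ ν) :=
  hypE2_eq ρ ν ▸
    isGaussContinuation_hyp2F1_three_halves (half_add_sub_half_sub_ne_intCast hν ρ)

theorem isGaussContinuation_hypF1 (hν : ∀ n : ℤ, ν ≠ n) (ρ : ℂ) :
    IsGaussContinuation ((ρ + ν) / 2) ((ρ + ν) / 2 + 1 / 2) ((ρ + ν) / 2 - (ρ - ν) / 2 + 1)
      (hypF1 ρ ν) :=
  hypF1_eq ρ ν ▸ isGaussContinuation_hyp2F1_add_half (half_add_sub_half_sub_ne_intCast hν ρ)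

theorem neg_cpow_mul_hypF1_one_div (hν : ∀ n : ℤ, ν ≠ n) (ρ : ℂ) {z : ℂ}
    (hz : z ∈ posCutPlane) :
    (-z) ^ (-(ρ + ν) / 2) * hypF1 ρ ν (1 / z) =
      connP ((ρ + ν) / 2) ((ρ - ν) / 2) * hypE1 ρ ν z +
        connQ ((ρ + ν) / 2) ((ρ - ν) / 2) * ((-z) ^ (1 / 2 : ℂ) * hypE2 ρ ν z) := by
  rw [hypF1_eq, hypE1, hypE2_eq, neg_div]
  exact neg_cpow_mul_hyp2F1_one_div (half_add_sub_half_sub_ne_intCast hν ρ) hz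

end HypergeometricFamilies

section NormalisedSolutions

/-- The conditions on `ρ` and `ν` under which every Gamma factor of the normalised solutions at zero
and at infinity is finite and the two solutions at infinity are independent. -/
structure IsGeneric (ρ ν : ℂ) : Prop where
  ne_intCast : ∀ n : ℤ, ν ≠ n
  add_ne_neg_natCast : ∀ n : ℕ, ρ + ν ≠ -n
  sub_ne_neg_natCast : ∀ n : ℕ, ρ - ν ≠ -n

/-- The factor which turns the connection coefficients of `hypG1 ρ ν` into products of
trigonometric functions and Gamma factors that are invariant under `ν ↦ -ν`. -/
noncomputable def gammaScale (ρ ν : ℂ) : ℂ :=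
  2 ^ (1 - (ρ + ν)) * Complex.Gamma (ρ + ν) / Complex.Gamma (1 + ν)

/-- The normalised solution at zero that is even in `√(-z)`. -/
noncomputable def evenSol (ρ ν z : ℂ) : ℂ :=
  Complex.Gamma ((ρ + ν) / 2) * Complex.Gamma ((ρ - ν) / 2) * hypE1 ρ ν z

/-- The normalised solution at zero that is odd in `√(-z)`. -/
noncomputable def oddSol (ρ ν z : ℂ) : ℂ :=
  2 * (Complex.Gamma ((ρ + ν) / 2 + 1 / 2) * Complex.Gamma ((ρ - ν) / 2 + 1 / 2)) *
    ((-z) ^ (1 / 2 : ℂ) * hypE2 ρ ν z)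

variable {ρ ν : ℂ}

theorem IsGeneric.neg (h : IsGeneric ρ ν) : IsGeneric ρ (-ν) where
  ne_intCast := neg_ne_intCast h.ne_intCast
  add_ne_neg_natCast := by simpa [← sub_eq_add_neg] using h.sub_ne_neg_natCast
  sub_ne_neg_natCast := by simpa using h.add_ne_neg_natCast

theorem evenSol_neg (ρ ν : ℂ) : evenSol ρ (-ν) = evenSol ρ ν := by
  funext z
  rw [evenSol, evenSol, hypE1_neg, sub_neg_eq_add, ← sub_eq_add_neg]
  ring

theorem oddSol_neg (ρ ν : ℂ) : oddSol ρ (-ν) = oddSol ρ ν := by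
  funext z
  rw [oddSol, oddSol, hypE2_neg, sub_neg_eq_add, ← sub_eq_add_neg]
  ring

theorem Gamma_half_mul_Gamma_half_add_half (s : ℂ) :
    Complex.Gamma (s / 2) * Complex.Gamma (s / 2 + 1 / 2) =
      2 ^ (1 - s) * Complex.Gamma s * (Real.sqrt Real.pi : ℂ) := by
  rw [Complex.Gamma_mul_Gamma_add_half, mul_div_cancel₀ s two_ne_zero, mul_comm (Complex.Gamma s)]

theorem Gamma_half_ne_zero {s : ℂ} (hs : ∀ n : ℕ, s ≠ -n) :
    Complex.Gamma (s / 2) ≠ 0 ∧ Complex.Gamma (s / 2 + 1 / 2) ≠ 0 := by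
  rw [← mul_ne_zero_iff, Gamma_half_mul_Gamma_half_add_half]
  exact mul_ne_zero (mul_ne_zero (by simp [Complex.cpow_eq_zero_iff])
    (Complex.Gamma_ne_zero hs)) sqrt_pi_ne_zero

theorem gammaScale_mul_sqrt_pi_mul_Gamma (hν : ∀ n : ℤ, ν ≠ n) (ρ : ℂ) :
    gammaScale ρ ν *
        ((Real.sqrt Real.pi : ℂ) * Complex.Gamma ((ρ + ν) / 2 - (ρ - ν) / 2 + 1)) =
      Complex.Gamma ((ρ + ν) / 2) * Complex.Gamma ((ρ + ν) / 2 + 1 / 2) := by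
  have hΓ : Complex.Gamma (1 + ν) ≠ 0 :=
    Complex.Gamma_ne_zero (by simpa [add_comm] using add_one_ne_neg_natCast hν)
  rw [Gamma_half_mul_Gamma_half_add_half, gammaScale,
    show (ρ + ν) / 2 - (ρ - ν) / 2 + 1 = 1 + ν by ring, div_mul_eq_mul_div, div_eq_iff hΓ]
  ring

theorem gammaScale_mul_connP (h : IsGeneric ρ ν) :
    gammaScale ρ ν * connP ((ρ + ν) / 2) ((ρ - ν) / 2) =
      Complex.Gamma ((ρ + ν) / 2) * Complex.Gamma ((ρ - ν) / 2) *
        (Complex.sin (Real.pi * ((ρ - ν) / 2)) / Real.pi) := by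
  have ha := (Gamma_half_ne_zero h.add_ne_neg_natCast).2
  have hb := (Gamma_half_ne_zero h.sub_ne_neg_natCast).1
  rw [← inv_Gamma_mul_inv_Gamma_one_sub, connP, ← mul_assoc, ← mul_assoc,
    gammaScale_mul_sqrt_pi_mul_Gamma h.ne_intCast, mul_inv_cancel_right₀ ha, mul_assoc _ (_ : ℂ),
    mul_inv_cancel_left₀ hb]

theorem gammaScale_mul_connQ (h : IsGeneric ρ ν) :
    gammaScale ρ ν * connQ ((ρ + ν) / 2) ((ρ - ν) / 2) =
      -(2 * (Complex.Gamma ((ρ + ν) / 2 + 1 / 2) * Complex.Gamma ((ρ - ν) / 2 + 1 / 2)) *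
        (Complex.cos (Real.pi * ((ρ - ν) / 2)) / Real.pi)) := by
  have ha := (Gamma_half_ne_zero h.add_ne_neg_natCast).1
  have hb := (Gamma_half_ne_zero h.sub_ne_neg_natCast).2
  have hscale := gammaScale_mul_sqrt_pi_mul_Gamma h.ne_intCast ρ
  rw [← inv_Gamma_add_half_mul_inv_Gamma_half_sub, connQ]
  linear_combination -2 * (Complex.Gamma ((ρ + ν) / 2))⁻¹ *
      (Complex.Gamma (1 / 2 - (ρ - ν) / 2))⁻¹ * hscale -
    2 * Complex.Gamma ((ρ + ν) / 2 + 1 / 2) * (Complex.Gamma (1 / 2 - (ρ - ν) / 2))⁻¹ *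
      (mul_inv_cancel₀ ha - mul_inv_cancel₀ hb)

theorem gammaScale_mul_neg_cpow_mul_hypF1 (h : IsGeneric ρ ν) {z : ℂ} (hz : z ∈ posCutPlane) :
    gammaScale ρ ν * ((-z) ^ (-(ρ + ν) / 2) * hypF1 ρ ν (1 / z)) =
      (Complex.sin (Real.pi * ((ρ - ν) / 2)) * evenSol ρ ν z -
        Complex.cos (Real.pi * ((ρ - ν) / 2)) * oddSol ρ ν z) / Real.pi := by
  rw [neg_cpow_mul_hypF1_one_div h.ne_intCast ρ hz, mul_add, ← mul_assoc, ← mul_assoc,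
    gammaScale_mul_connP h, gammaScale_mul_connQ h, evenSol, oddSol]
  ring

end NormalisedSolutions

section BilinearIdentity

theorem sin_add_int_mul_pi (x : ℂ) (n : ℤ) :
    Complex.sin (x + n * Real.pi) = (-1) ^ n * Complex.sin x :=
  n.cast_negOnePow ℂ ▸ Complex.sin_antiperiodic.add_int_mul_eq n

theorem cos_add_int_mul_pi (x : ℂ) (n : ℤ) :
    Complex.cos (x + n * Real.pi) = (-1) ^ n * Complex.cos x :=
  n.cast_negOnePow ℂ ▸ Complex.cos_antiperiodic.add_int_mul_eq n

theorem exp_neg_int_mul_pi_mul_I (n : ℤ) :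
    Complex.exp (-(n * (Real.pi * Complex.I))) = (-1) ^ n := by
  rw [Complex.exp_neg, Complex.exp_int_mul, Complex.exp_pi_mul_I, ← inv_zpow, inv_neg_one]

variable {ρ μ ν ν' z : ℂ} {d : ℤ} {θ : ℝ}

theorem hypG1_mul_hypG1_conj {n : ℤ} (hn : ν - ν' = 2 * n) (hz : z ≠ 0)
    (hθ : θ ∈ Set.Ioo 0 (2 * Real.pi)) (h : z = ‖z‖ * Complex.exp (θ * Complex.I)) (ρ : ℂ) :
    hypG1 ρ ν z θ * hypG1 ρ ν' (starRingEnd ℂ z) (-θ) =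
      (-1) ^ n * ((-z) ^ (-(ρ + ν) / 2) * hypF1 ρ ν (1 / z) *
        ((-starRingEnd ℂ z) ^ (-(ρ + ν') / 2) * hypF1 ρ ν' (1 / starRingEnd ℂ z))) := by
  have hexp : Complex.exp (Real.pi * Complex.I * (-(ρ + ν) / 2)) *
      Complex.exp (-(Real.pi * Complex.I * (-(ρ + ν') / 2))) = (-1) ^ n := by
    rw [← Complex.exp_add, ← exp_neg_int_mul_pi_mul_I]
    congr 1
    linear_combination -(Real.pi * Complex.I) / 2 * hn
  rw [hypG1, hypG1, powArg_eq_neg_cpow hz hθ h, powArg_conj_eq_neg_cpow hz hθ h, ← hexp]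
  ring

theorem gammaScale_mul_hypG1_mul_hypG1_conj (hν : IsGeneric ρ ν) (hν' : IsGeneric ρ ν') {n : ℤ}
    (hn : ν - ν' = 2 * n) (hz : z ≠ 0) (hθ : θ ∈ Set.Ioo 0 (2 * Real.pi))
    (h : z = ‖z‖ * Complex.exp (θ * Complex.I)) :
    gammaScale ρ ν * gammaScale ρ ν' *
        (hypG1 ρ ν z θ * hypG1 ρ ν' (starRingEnd ℂ z) (-θ)) =
      (Complex.sin (Real.pi * ((ρ - ν) / 2)) * evenSol ρ ν z -
          Complex.cos (Real.pi * ((ρ - ν) / 2)) * oddSol ρ ν z) *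
        (Complex.sin (Real.pi * ((ρ - ν) / 2)) * evenSol ρ ν' (starRingEnd ℂ z) -
          Complex.cos (Real.pi * ((ρ - ν) / 2)) * oddSol ρ ν' (starRingEnd ℂ z)) /
        Real.pi ^ 2 := by
  have hmem := mem_posCutPlane_of_arg hz hθ h
  have hsol := gammaScale_mul_neg_cpow_mul_hypF1 hν hmem
  have hsol' := gammaScale_mul_neg_cpow_mul_hypF1 hν' (conj_mem_posCutPlane hmem)
  have hshift : (Real.pi : ℂ) * ((ρ - ν') / 2) = Real.pi * ((ρ - ν) / 2) + n * Real.pi := by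
    linear_combination (Real.pi : ℂ) / 2 * hn
  have hsign : ((-1) ^ n * (-1) ^ n : ℂ) = 1 := by
    rw [← mul_zpow, neg_one_mul, neg_neg, one_zpow]
  rw [hshift, sin_add_int_mul_pi, cos_add_int_mul_pi] at hsol'
  rw [hypG1_mul_hypG1_conj hn hz hθ h, mul_left_comm, mul_mul_mul_comm, hsol, hsol']
  linear_combination (Complex.sin (Real.pi * ((ρ - ν) / 2)) * evenSol ρ ν z -
      Complex.cos (Real.pi * ((ρ - ν) / 2)) * oddSol ρ ν z) *
    (Complex.sin (Real.pi * ((ρ - ν) / 2)) * evenSol ρ ν' (starRingEnd ℂ z) -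
      Complex.cos (Real.pi * ((ρ - ν) / 2)) * oddSol ρ ν' (starRingEnd ℂ z)) /
    Real.pi ^ 2 * hsign

theorem sin_two_mul_mul_sub_sin_two_mul_mul (α β U V U' V' : ℂ) :
    Complex.sin (2 * β) * ((Complex.sin α * U - Complex.cos α * V) *
        (Complex.sin α * U' - Complex.cos α * V')) -
      Complex.sin (2 * α) * ((Complex.sin β * U - Complex.cos β * V) *
        (Complex.sin β * U' - Complex.cos β * V')) =
      2 * Complex.sin (α - β) * (Complex.sin α * Complex.sin β * (U * U') -
        Complex.cos α * Complex.cos β * (V * V')) := by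
  rw [Complex.sin_two_mul, Complex.sin_two_mul, Complex.sin_sub]
  ring

theorem two_cpow_mul_two_cpow_mul_two_pi_cpow (ρ μ δ : ℂ) :
    (2 : ℂ) ^ (1 - (ρ + (μ + δ))) * 2 ^ (1 - (ρ + (μ - δ))) * (2 * Real.pi) ^ (2 * ρ) =
      4 ^ (-μ) * (4 * (Real.pi : ℂ) ^ (2 * ρ)) := by
  have hpi : (2 * Real.pi : ℂ) ^ (2 * ρ) = 2 ^ (2 * ρ) * (Real.pi : ℂ) ^ (2 * ρ) :=
    mod_cast Complex.mul_cpow_ofReal_nonneg zero_le_two Real.pi_pos.le (2 * ρ)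
  have hfour : (4 : ℂ) ^ (-μ) = 2 ^ (-μ) * 2 ^ (-μ) := by
    rw [← Complex.ofReal_ofNat 2, ← Complex.mul_cpow_ofReal_nonneg zero_le_two zero_le_two]
    norm_num
  have htwo : (2 : ℂ) ^ (1 - (ρ + (μ + δ))) * 2 ^ (1 - (ρ + (μ - δ))) * 2 ^ (2 * ρ) =
      2 ^ (-μ) * 2 ^ (-μ) * 2 ^ (2 : ℂ) := by
    simp only [← Complex.cpow_add _ _ (two_ne_zero' ℂ)]
    ring_nf
  rw [Complex.cpow_ofNat] at htwo
  rw [hpi, hfour]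
  linear_combination (Real.pi : ℂ) ^ (2 * ρ) * htwo

theorem four_cpow_mul_coeffC (ρ μ : ℂ) (d : ℤ) :
    4 ^ (-μ) * coeffC ρ μ d =
      -(Complex.sin (Real.pi * (ρ + (μ + d))) /
          (4 * (Real.pi : ℂ) ^ (2 * ρ) * Complex.sin (Real.pi * (μ + d)))) *
        (gammaScale ρ (μ + d) * gammaScale ρ (μ - d)) := by
  have hcpow : (4 : ℂ) ^ (-μ) / (2 * Real.pi) ^ (2 * ρ) =
      2 ^ (1 - (ρ + (μ + d))) * 2 ^ (1 - (ρ + (μ - d))) / (4 * (Real.pi : ℂ) ^ (2 * ρ)) := by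
    have hpi : (Real.pi : ℂ) ≠ 0 := Complex.ofReal_ne_zero.2 Real.pi_ne_zero
    rw [div_eq_div_iff (by simp [Complex.cpow_eq_zero_iff, hpi])
      (by simp [Complex.cpow_eq_zero_iff, hpi]), two_cpow_mul_two_cpow_mul_two_pi_cpow]
  have hsin (x : ℂ) :
      Complex.sin (Real.pi * (x + d)) = (-1) ^ d * Complex.sin (Real.pi * x) := by
    rw [mul_add, mul_comm (Real.pi : ℂ) d, sin_add_int_mul_pi]
  have hratio : Complex.sin (Real.pi * (ρ + (μ + d))) / Complex.sin (Real.pi * (μ + d)) =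
      Complex.sin (Real.pi * (ρ + μ)) / Complex.sin (Real.pi * μ) := by
    rw [← add_assoc, hsin, hsin, mul_div_mul_left _ _ (zpow_ne_zero d (neg_ne_zero.2 one_ne_zero))]
  calc 4 ^ (-μ) * coeffC ρ μ d
      = -(4 ^ (-μ) / (2 * Real.pi) ^ (2 * ρ)) *
          (Complex.sin (Real.pi * (ρ + μ)) / Complex.sin (Real.pi * μ)) *
          (Complex.Gamma (ρ + (μ + d)) * Complex.Gamma (ρ + (μ - d)) /
            (Complex.Gamma (1 + (μ + d)) * Complex.Gamma (1 + (μ - d)))) := by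
        rw [coeffC, ← add_assoc, ← add_sub_assoc, ← add_assoc, ← add_sub_assoc]
        ring
    _ = _ := by
        rw [hcpow, ← hratio, gammaScale, gammaScale]
        ring

theorem pi_cpow_two_mul_add_two (ρ : ℂ) :
    (Real.pi : ℂ) ^ (2 * ρ + 2) = (Real.pi : ℂ) ^ (2 * ρ) * (Real.pi : ℂ) ^ 2 := by
  rw [Complex.cpow_add _ _ (Complex.ofReal_ne_zero.2 Real.pi_ne_zero), Complex.cpow_ofNat]

theorem cos_half_sub_half (ρ μ : ℂ) (d : ℤ) :
    Complex.cos (Real.pi * ((ρ + (μ + d)) / 2) - Real.pi * ((ρ - (μ + d)) / 2)) =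
      (-1) ^ d * Complex.cos (Real.pi * μ) := by
  rw [← cos_add_int_mul_pi]
  ring_nf

theorem cos_half_add_half (ρ ν : ℂ) :
    Complex.cos (Real.pi * ((ρ + ν) / 2) + Real.pi * ((ρ - ν) / 2)) =
      Complex.cos (Real.pi * ρ) := by
  ring_nf

theorem coeffB_eq_sin_mul_sin (ρ μ : ℂ) (d : ℤ) :
    coeffB ρ μ d =
      Complex.sin (Real.pi * ((ρ + (μ + d)) / 2)) * Complex.sin (Real.pi * ((ρ - (μ + d)) / 2)) /
        (2 * (Real.pi : ℂ) ^ (2 * ρ) * (Real.pi : ℂ) ^ 2) := by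
  rw [coeffB, pi_cpow_two_mul_add_two, ← cos_half_sub_half ρ, ← cos_half_add_half ρ (μ + d),
    Complex.cos_sub, Complex.cos_add]
  ring

theorem coeffB_add_one_eq_neg_cos_mul_cos (ρ μ : ℂ) (d : ℤ) :
    coeffB ρ μ (d + 1) =
      -(Complex.cos (Real.pi * ((ρ + (μ + d)) / 2)) *
          Complex.cos (Real.pi * ((ρ - (μ + d)) / 2))) /
        (2 * (Real.pi : ℂ) ^ (2 * ρ) * (Real.pi : ℂ) ^ 2) := by
  rw [coeffB, pi_cpow_two_mul_add_two, zpow_add_one₀ (neg_ne_zero.2 one_ne_zero), mul_neg_one,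
    neg_mul, ← cos_half_sub_half ρ, ← cos_half_add_half ρ (μ + d), Complex.cos_sub,
    Complex.cos_add]
  ring

theorem evenSol_mul_evenSol (ρ μ : ℂ) (d : ℤ) (z z' : ℂ) :
    evenSol ρ (μ + d) z * evenSol ρ (μ - d) z' =
      coeffA1 ρ μ d * (hypE1 ρ (μ + d) z * hypE1 ρ (μ - d) z') := by
  rw [evenSol, evenSol, coeffA1]
  ring_nf

theorem oddSol_mul_oddSol_conj (ρ μ : ℂ) (d : ℤ) (hz : z ∈ posCutPlane) :
    oddSol ρ (μ + d) z * oddSol ρ (μ - d) (starRingEnd ℂ z) =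
      coeffA2 ρ μ d * (4 * ‖z‖) *
        (hypE2 ρ (μ + d) z * hypE2 ρ (μ - d) (starRingEnd ℂ z)) := by
  rw [← neg_cpow_half_mul_conj hz, oddSol, oddSol, coeffA2]
  ring_nf

theorem combZero_eq (ρ μ : ℂ) (d : ℤ) (hz : z ∈ posCutPlane) :
    combZero ρ μ d z =
      (Complex.sin (Real.pi * ((ρ + (μ + d)) / 2)) * Complex.sin (Real.pi * ((ρ - (μ + d)) / 2)) *
          (evenSol ρ (μ + d) z * evenSol ρ (μ - d) (starRingEnd ℂ z)) -
        Complex.cos (Real.pi * ((ρ + (μ + d)) / 2)) * Complex.cos (Real.pi * ((ρ - (μ + d)) / 2)) *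
          (oddSol ρ (μ + d) z * oddSol ρ (μ - d) (starRingEnd ℂ z))) /
        (2 * (Real.pi : ℂ) ^ (2 * ρ) * (Real.pi : ℂ) ^ 2) := by
  rw [combZero, coeffB_eq_sin_mul_sin, coeffB_add_one_eq_neg_cos_mul_cos, evenSol_mul_evenSol,
    oddSol_mul_oddSol_conj ρ μ d hz]
  ring

theorem four_cpow_mul_coeffC_neg (ρ μ : ℂ) (d : ℤ) :
    4 ^ μ * coeffC ρ (-μ) (-d) =
      Complex.sin (Real.pi * (ρ - (μ + d))) /
          (4 * (Real.pi : ℂ) ^ (2 * ρ) * Complex.sin (Real.pi * (μ + d))) *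
        (gammaScale ρ (-(μ + d)) * gammaScale ρ (-(μ - d))) := by
  have h := four_cpow_mul_coeffC ρ (-μ) (-d)
  rw [neg_neg, Int.cast_neg, ← neg_add, sub_neg_eq_add, neg_add_eq_sub, ← neg_sub μ, mul_neg,
    Complex.sin_neg, mul_neg, div_neg, neg_neg, ← sub_eq_add_neg] at h
  exact h

theorem combInfinity_eq_combZero (h₁ : IsGeneric ρ (μ + d)) (h₂ : IsGeneric ρ (μ - d))
    (hz : z ≠ 0) (hθ : θ ∈ Set.Ioo 0 (2 * Real.pi))
    (h : z = ‖z‖ * Complex.exp (θ * Complex.I)) :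
    combInfinity ρ μ d z θ = combZero ρ μ d z := by
  have hG1 := gammaScale_mul_hypG1_mul_hypG1_conj h₁ h₂ (n := d) (by ring) hz hθ h
  have hG2 := gammaScale_mul_hypG1_mul_hypG1_conj h₁.neg h₂.neg (n := -d) (by push_cast; ring)
    hz hθ h
  have hsin : Complex.sin (Real.pi * (μ + d)) ≠ 0 :=
    sin_pi_mul_ne_zero fun ⟨n, hn⟩ => h₁.ne_intCast n hn.symm
  rw [sub_neg_eq_add, evenSol_neg, evenSol_neg, oddSol_neg, oddSol_neg] at hG2
  rw [combZero_eq ρ μ d (mem_posCutPlane_of_arg hz hθ h), combInfinity, hypG2_eq_hypG1,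
    hypG2_eq_hypG1, four_cpow_mul_coeffC, four_cpow_mul_coeffC_neg]
  have hα : 2 * ((Real.pi : ℂ) * ((ρ + (μ + d)) / 2)) = Real.pi * (ρ + (μ + d)) := by ring
  have hβ : 2 * ((Real.pi : ℂ) * ((ρ - (μ + d)) / 2)) = Real.pi * (ρ - (μ + d)) := by ring
  have hαβ : (Real.pi : ℂ) * ((ρ + (μ + d)) / 2) - Real.pi * ((ρ - (μ + d)) / 2) =
      Real.pi * (μ + d) := by ring
  have htrig := sin_two_mul_mul_sub_sin_two_mul_mul (Real.pi * ((ρ + (μ + d)) / 2))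
    (Real.pi * ((ρ - (μ + d)) / 2)) (evenSol ρ (μ + d) z) (oddSol ρ (μ + d) z)
    (evenSol ρ (μ - d) (starRingEnd ℂ z)) (oddSol ρ (μ - d) (starRingEnd ℂ z))
  rw [hα, hβ, hαβ, mul_comm (2 * _) (_ - _), ← div_eq_iff (mul_ne_zero two_ne_zero hsin)] at htrig
  rw [← htrig]
  linear_combination Complex.sin (Real.pi * (ρ - (μ + d))) /
        (4 * (Real.pi : ℂ) ^ (2 * ρ) * Complex.sin (Real.pi * (μ + d))) * hG2 -
      Complex.sin (Real.pi * (ρ + (μ + d))) /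
        (4 * (Real.pi : ℂ) ^ (2 * ρ) * Complex.sin (Real.pi * (μ + d))) * hG1

end BilinearIdentity

section ArgumentIndependence

theorem hypG1_mul_hypG1_add_two_pi_mul_int {ν ν' : ℂ} {m : ℤ} (h : ν - ν' = 2 * m)
    (ρ z z' : ℂ) (θ : ℝ) (k : ℤ) :
    hypG1 ρ ν z (θ + 2 * Real.pi * k) * hypG1 ρ ν' z' (-(θ + 2 * Real.pi * k)) =
      hypG1 ρ ν z θ * hypG1 ρ ν' z' (-θ) := by
  have hneg : -(θ + 2 * Real.pi * k) = -θ + 2 * Real.pi * (-k : ℤ) := by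
    push_cast
    ring
  have hexp : Complex.exp (2 * Real.pi * k * Complex.I * (-(ρ + ν) / 2)) *
      Complex.exp (2 * Real.pi * (-k : ℤ) * Complex.I * (-(ρ + ν') / 2)) = 1 := by
    rw [← Complex.exp_add, Complex.exp_eq_one_iff]
    refine ⟨-(k * m), ?_⟩
    push_cast
    linear_combination -(Real.pi * k * Complex.I) * h
  rw [hneg, hypG1, hypG1, hypG1, hypG1, powArg_add_two_pi_mul_int, powArg_add_two_pi_mul_int]
  linear_combination powArg z θ (-(ρ + ν) / 2) * hypF1 ρ ν (1 / z) *
    (powArg z' (-θ) (-(ρ + ν') / 2) * hypF1 ρ ν' (1 / z')) * hexp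

theorem combInfinity_add_two_pi_mul_int (ρ μ : ℂ) (d : ℤ) (z : ℂ) (θ : ℝ) (k : ℤ) :
    combInfinity ρ μ d z (θ + 2 * Real.pi * k) = combInfinity ρ μ d z θ := by
  have h1 := hypG1_mul_hypG1_add_two_pi_mul_int (ν := μ + d) (ν' := μ - d) (m := d) (by ring)
    ρ z (starRingEnd ℂ z) θ k
  have h2 := hypG1_mul_hypG1_add_two_pi_mul_int (ν := -(μ + d)) (ν' := -(μ - d)) (m := -d)
    (by push_cast; ring) ρ z (starRingEnd ℂ z) θ k
  simp only [combInfinity, hypG2_eq_hypG1]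
  linear_combination (4 : ℂ) ^ (-μ) * coeffC ρ μ d * h1 + (4 : ℂ) ^ μ * coeffC ρ (-μ) (-d) * h2

theorem combInfinity_congr_arg (ρ μ : ℂ) (d : ℤ) {z : ℂ} (hz : z ≠ 0) {θ θ' : ℝ}
    (h : z = ‖z‖ * Complex.exp (θ * Complex.I)) (h' : z = ‖z‖ * Complex.exp (θ' * Complex.I)) :
    combInfinity ρ μ d z θ = combInfinity ρ μ d z θ' := by
  have hnorm : (‖z‖ : ℂ) ≠ 0 := Complex.ofReal_ne_zero.2 (norm_ne_zero_iff.2 hz)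
  obtain ⟨k, hk⟩ := Complex.exp_eq_exp_iff_exists_int.1 (mul_left_cancel₀ hnorm (h.symm.trans h'))
  have hθ : (θ : ℂ) = θ' + 2 * Real.pi * k :=
    mul_right_cancel₀ Complex.I_ne_zero (by linear_combination hk)
  rw [show θ = θ' + 2 * Real.pi * k from mod_cast hθ, combInfinity_add_two_pi_mul_int]

end ArgumentIndependence

section Regularity

open Filter

theorem continuousOn_hypE1 {ρ ν : ℂ} (hν : ∀ n : ℤ, ν ≠ n) (hρ : ρ.re < 1 / 2) :
    ContinuousOn (hypE1 ρ ν) (Metric.closedBall 0 1) :=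
  continuousOn_hyp2F1 (isGaussContinuation_hypE1 hν ρ)
    (ne_neg_natCast_of_re_pos (by norm_num)) (re_neg_of_eq_sub_half hρ (by ring))

theorem continuousOn_hypE2 {ρ ν : ℂ} (hν : ∀ n : ℤ, ν ≠ n) (hρ : ρ.re < 1 / 2) :
    ContinuousOn (hypE2 ρ ν) (Metric.closedBall 0 1) := by
  have h := isGaussContinuation_hypE2 hν ρ
  rw [hypE2_eq] at h ⊢
  exact continuousOn_hyp2F1 h (ne_neg_natCast_of_re_pos (by norm_num))
    (re_neg_of_eq_sub_half hρ (by ring))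

theorem continuousOn_hypF1 {ρ ν : ℂ} (hν : ∀ n : ℤ, ν ≠ n) (hρ : ρ.re < 1 / 2) :
    ContinuousOn (hypF1 ρ ν) (Metric.closedBall 0 1) := by
  have h := isGaussContinuation_hypF1 hν ρ
  rw [hypF1_eq] at h ⊢
  exact continuousOn_hyp2F1 h
    (add_one_ne_neg_natCast (half_add_sub_half_sub_ne_intCast hν ρ))
    (re_neg_of_eq_sub_half hρ (by ring))

theorem add_intCast_ne_intCast {s : ℂ} (hs : ∀ n : ℤ, s ≠ n) (d n : ℤ) : s + d ≠ n := fun h =>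
  hs (n - d) (by rw [Int.cast_sub, ← h, add_sub_cancel_right])

theorem sub_intCast_ne_intCast {s : ℂ} (hs : ∀ n : ℤ, s ≠ n) (d n : ℤ) : s - d ≠ n := fun h =>
  hs (n + d) (by rw [Int.cast_add, ← h, sub_add_cancel])

variable {ρ μ ν : ℂ} {d : ℤ}

theorem continuousOn_combZero (hμ : ∀ n : ℤ, μ ≠ n) (hρ : ρ.re < 1 / 2) (d : ℤ) :
    ContinuousOn (combZero ρ μ d) (Metric.closedBall 0 1) := by
  have hmaps : Set.MapsTo (starRingEnd ℂ) (Metric.closedBall (0 : ℂ) 1) (Metric.closedBall 0 1) :=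
    fun z hz => by rwa [mem_closedBall_zero_iff, Complex.norm_conj, ← mem_closedBall_zero_iff]
  have hconj : ContinuousOn (starRingEnd ℂ) (Metric.closedBall (0 : ℂ) 1) :=
    Complex.continuous_conj.continuousOn
  have hadd := add_intCast_ne_intCast hμ d
  have hsub := sub_intCast_ne_intCast hμ d
  exact ((continuousOn_const.mul (continuousOn_hypE1 hadd hρ)).mul
    ((continuousOn_hypE1 hsub hρ).comp hconj hmaps)).add
    (((continuousOn_const.mul (by fun_prop)).mul (continuousOn_hypE2 hadd hρ)).mul
      ((continuousOn_hypE2 hsub hρ).comp hconj hmaps))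

theorem analyticAt_conj_comp {g : ℂ → ℂ} {w : ℂ} (hg : AnalyticAt ℝ g w) :
    AnalyticAt ℝ (fun u => starRingEnd ℂ (g u)) w :=
  (Complex.conjCLE.toContinuousLinearMap.analyticAt (g w)).fun_comp hg

theorem analyticAt_real_comp {F g : ℂ → ℂ} {w : ℂ} (hF : AnalyticAt ℂ F (g w))
    (hg : AnalyticAt ℝ g w) : AnalyticAt ℝ (fun u => F (g u)) w :=
  (hF.restrictScalars (𝕜 := ℝ)).fun_comp hg

theorem analyticAt_combZero_comp (hμ : ∀ n : ℤ, μ ≠ n) {g : ℂ → ℂ} {w : ℂ}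
    (hg : AnalyticAt ℝ g w) (hnorm : AnalyticAt ℝ (fun u => (‖g u‖ : ℂ)) w)
    (hw : g w ∈ cutPlane) : AnalyticAt ℝ (fun u => combZero ρ μ d (g u)) w := by
  have hadd := add_intCast_ne_intCast hμ d
  have hsub := sub_intCast_ne_intCast hμ d
  have hw' := conj_mem_cutPlane hw
  have hg' := analyticAt_conj_comp hg
  exact ((analyticAt_const.mul
    (analyticAt_real_comp ((isGaussContinuation_hypE1 hadd ρ).1 _ hw) hg)).mul
    (analyticAt_real_comp ((isGaussContinuation_hypE1 hsub ρ).1 _ hw') hg')).add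
    (((analyticAt_const.mul (analyticAt_const.mul hnorm)).mul
      (analyticAt_real_comp ((isGaussContinuation_hypE2 hadd ρ).1 _ hw) hg)).mul
      (analyticAt_real_comp ((isGaussContinuation_hypE2 hsub ρ).1 _ hw') hg'))

theorem analyticAt_ofReal_norm {z : ℂ} (hz : z ≠ 0) : AnalyticAt ℝ (fun u : ℂ => (‖u‖ : ℂ)) z :=
  (Complex.ofRealCLM.analyticAt ‖z‖).fun_comp (contDiffAt_norm ℝ hz).analyticAt

theorem analyticAt_ofReal_norm_sq (w : ℂ) : AnalyticAt ℝ (fun u : ℂ => (‖u ^ 2‖ : ℂ)) w := by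
  simp only [norm_pow, Complex.ofReal_pow, ← Complex.mul_conj']
  exact analyticAt_id.mul (analyticAt_conj_comp analyticAt_id)

theorem hypG1_arg (ρ ν z : ℂ) :
    hypG1 ρ ν z z.arg = Complex.exp (-(ρ + ν) / 2 * Complex.log z) * hypF1 ρ ν (1 / z) := by
  rw [hypG1, powArg, Complex.log]

theorem analyticAt_hypG1_arg (hν : ∀ n : ℤ, ν ≠ n) {z : ℂ} (hz : z ∈ Complex.slitPlane)
    (hz' : 1 / z ∈ cutPlane) : AnalyticAt ℂ (fun u => hypG1 ρ ν u u.arg) z := by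
  simp only [hypG1_arg]
  exact (analyticAt_const.mul (analyticAt_clog hz)).cexp.mul
    (((isGaussContinuation_hypF1 hν ρ).1 _ hz').fun_comp
      (analyticAt_const.div analyticAt_id (Complex.slitPlane_ne_zero hz)))

theorem continuousOn_one_div : ContinuousOn (fun z : ℂ => 1 / z) {z | 1 ≤ ‖z‖} :=
  continuousOn_const.div continuousOn_id fun _ (hz : 1 ≤ _) => norm_pos_iff.1 (one_pos.trans_le hz)

theorem one_div_mem_closedBall {z : ℂ} (hz : 1 ≤ ‖z‖) : 1 / z ∈ Metric.closedBall (0 : ℂ) 1 := by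
  rw [mem_closedBall_zero_iff, norm_div, norm_one]
  exact div_le_one_of_le₀ hz (norm_nonneg _)

theorem continuousWithinAt_hypG1_arg (hν : ∀ n : ℤ, ν ≠ n) (hρ : ρ.re < 1 / 2) :
    ContinuousWithinAt (fun u => hypG1 ρ ν u u.arg) {z | 1 ≤ ‖z‖} 1 := by
  simp only [hypG1_arg]
  have hlog := continuousAt_clog Complex.one_mem_slitPlane
  exact (hlog.const_mul _).cexp.continuousWithinAt.mul
    ((continuousOn_hypF1 hν hρ).comp continuousOn_one_div
      (fun z hz => one_div_mem_closedBall hz) 1 (by simp))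

theorem combInfinity_arg (ρ μ : ℂ) (d : ℤ) {z : ℂ} (hz : z ∈ Complex.slitPlane) :
    combInfinity ρ μ d z z.arg =
      4 ^ (-μ) * coeffC ρ μ d * hypG1 ρ (μ + d) z z.arg *
          hypG1 ρ (μ - d) (starRingEnd ℂ z) (starRingEnd ℂ z).arg +
        4 ^ μ * coeffC ρ (-μ) (-d) * hypG1 ρ (-(μ + d)) z z.arg *
          hypG1 ρ (-(μ - d)) (starRingEnd ℂ z) (starRingEnd ℂ z).arg := by
  rw [combInfinity, Complex.arg_conj, if_neg (Complex.mem_slitPlane_iff_arg.1 hz).1,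
    hypG2_eq_hypG1, hypG2_eq_hypG1]

theorem analyticAt_combInfinity_arg (hμ : ∀ n : ℤ, μ ≠ n) {z : ℂ}
    (hz : z ∈ Complex.slitPlane) (hz' : 1 / z ∈ cutPlane) :
    AnalyticAt ℝ (fun u => combInfinity ρ μ d u u.arg) z := by
  have hG {ν : ℂ} (hν : ∀ n : ℤ, ν ≠ n) : AnalyticAt ℝ (fun u => hypG1 ρ ν u u.arg) z :=
    (analyticAt_hypG1_arg hν hz hz').restrictScalars
  have hG' {ν : ℂ} (hν : ∀ n : ℤ, ν ≠ n) :
      AnalyticAt ℝ (fun u => hypG1 ρ ν (starRingEnd ℂ u) (starRingEnd ℂ u).arg) z := by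
    have hconj : starRingEnd ℂ z ∈ Complex.slitPlane :=
      Complex.mem_slitPlane_iff.2 (by simpa using Complex.mem_slitPlane_iff.1 hz)
    have hdiv : 1 / starRingEnd ℂ z ∈ cutPlane := by
      simpa only [map_div₀, map_one] using conj_mem_cutPlane hz'
    exact analyticAt_real_comp (analyticAt_hypG1_arg hν hconj hdiv)
      (analyticAt_conj_comp analyticAt_id)
  have hadd := add_intCast_ne_intCast hμ d
  have hsub := sub_intCast_ne_intCast hμ d
  refine AnalyticAt.congr ?_ (eventuallyEq_of_mem (Complex.isOpen_slitPlane.mem_nhds hz)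
    fun u hu => (combInfinity_arg ρ μ d hu).symm)
  exact ((analyticAt_const.mul (hG hadd)).mul (hG' hsub)).add
    ((analyticAt_const.mul (hG (neg_ne_intCast hadd))).mul (hG' (neg_ne_intCast hsub)))

theorem continuousWithinAt_combInfinity_arg (hμ : ∀ n : ℤ, μ ≠ n) (hρ : ρ.re < 1 / 2) (d : ℤ) :
    ContinuousWithinAt (fun u => combInfinity ρ μ d u u.arg) {z | 1 ≤ ‖z‖} 1 := by
  have hG {ν : ℂ} (hν : ∀ n : ℤ, ν ≠ n) := continuousWithinAt_hypG1_arg hν hρ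
  have hG' {ν : ℂ} (hν : ∀ n : ℤ, ν ≠ n) :
      ContinuousWithinAt (fun u => hypG1 ρ ν (starRingEnd ℂ u) (starRingEnd ℂ u).arg)
        {z | 1 ≤ ‖z‖} 1 :=
    ContinuousWithinAt.comp (f := starRingEnd ℂ) (g := fun u => hypG1 ρ ν u u.arg)
      (by simpa only [map_one] using hG hν) Complex.continuous_conj.continuousWithinAt
      fun z hz => by simpa using hz
  have hadd := add_intCast_ne_intCast hμ d
  have hsub := sub_intCast_ne_intCast hμ d
  refine ContinuousWithinAt.congr_of_eventuallyEq ?_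
    (eventuallyEq_of_mem (mem_nhdsWithin_of_mem_nhds
      (Complex.isOpen_slitPlane.mem_nhds Complex.one_mem_slitPlane))
      fun u hu => combInfinity_arg ρ μ d hu) (combInfinity_arg ρ μ d Complex.one_mem_slitPlane)
  exact ((continuousWithinAt_const.mul (hG hadd)).mul (hG' hsub)).add
    ((continuousWithinAt_const.mul (hG (neg_ne_intCast hadd))).mul (hG' (neg_ne_intCast hsub)))

end Regularity

section Gluing

open Filter Topology

/-- The combination at zero on the closed unit disc and, with principal arguments, the combination
at infinity outside of it: the common extension of the two sides of the bilinear identity. -/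
noncomputable def combGlued (ρ μ : ℂ) (d : ℤ) (z : ℂ) : ℂ :=
  if ‖z‖ ≤ 1 then combZero ρ μ d z else combInfinity ρ μ d z z.arg

variable {ρ μ : ℂ} {d : ℤ}

theorem IsGeneric.ne_intCast_of_add_intCast (h : IsGeneric ρ (μ + d)) (n : ℤ) : μ ≠ n :=
  add_sub_cancel_right μ (d : ℂ) ▸ sub_intCast_ne_intCast h.ne_intCast d n

theorem combInfinity_arg_eq_combZero (h₁ : IsGeneric ρ (μ + d)) (h₂ : IsGeneric ρ (μ - d))
    {z : ℂ} (hz : z ∈ posCutPlane) : combInfinity ρ μ d z z.arg = combZero ρ μ d z := by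
  obtain ⟨θ, hθ, h⟩ := exists_arg_mem_Ioo hz
  have hz0 := ne_zero_of_mem_posCutPlane hz
  rw [← combInfinity_congr_arg ρ μ d hz0 h (Complex.norm_mul_exp_arg_mul_I z).symm]
  exact combInfinity_eq_combZero h₁ h₂ hz0 hθ h

theorem tendsto_exp_ofReal_mul_I_nhdsGT_zero :
    Tendsto (fun t : ℝ => Complex.exp (t * Complex.I)) (𝓝[>] 0) (𝓝 1) := by
  have hcont : ContinuousAt (fun t : ℝ => Complex.exp (t * Complex.I)) 0 := by fun_prop
  simpa using hcont.tendsto.mono_left nhdsWithin_le_nhds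

theorem exp_ofReal_mul_I_mem_posCutPlane {t : ℝ} (ht : t ∈ Set.Ioo 0 Real.pi) :
    Complex.exp (t * Complex.I) ∈ posCutPlane :=
  mem_posCutPlane_of_arg (Complex.exp_ne_zero _) ⟨ht.1, by linarith [ht.1, ht.2]⟩
    (by rw [Complex.norm_exp_ofReal_mul_I, Complex.ofReal_one, one_mul])

theorem combInfinity_one (h₁ : IsGeneric ρ (μ + d)) (h₂ : IsGeneric ρ (μ - d))
    (hρ : ρ.re < 1 / 2) : combInfinity ρ μ d 1 (1 : ℂ).arg = combZero ρ μ d 1 := by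
  have hμ := h₁.ne_intCast_of_add_intCast
  have hout := (continuousWithinAt_combInfinity_arg hμ hρ d).tendsto.comp
    (tendsto_nhdsWithin_iff.2 ⟨tendsto_exp_ofReal_mul_I_nhdsGT_zero,
      Eventually.of_forall fun t => (Complex.norm_exp_ofReal_mul_I t).ge⟩)
  have hin := (continuousOn_combZero hμ hρ d 1 (by simp)).tendsto.comp
    (tendsto_nhdsWithin_iff.2 ⟨tendsto_exp_ofReal_mul_I_nhdsGT_zero,
      Eventually.of_forall fun t =>
        mem_closedBall_zero_iff.2 (Complex.norm_exp_ofReal_mul_I t).le⟩)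
  refine tendsto_nhds_unique_of_eventuallyEq hout hin ?_
  filter_upwards [Ioo_mem_nhdsGT Real.pi_pos] with t ht
  exact combInfinity_arg_eq_combZero h₁ h₂ (exp_ofReal_mul_I_mem_posCutPlane ht)

theorem combGlued_eq_combZero (h₁ : IsGeneric ρ (μ + d)) (h₂ : IsGeneric ρ (μ - d)) {z : ℂ}
    (hz : z ∉ Complex.ofReal '' Set.Ioi (1 : ℝ)) : combGlued ρ μ d z = combZero ρ μ d z := by
  rw [combGlued]
  split_ifs with h
  · rfl
  · refine combInfinity_arg_eq_combZero h₁ h₂ (mem_posCutPlane_iff_notMem_image.2 ?_)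
    rintro ⟨x, hx, rfl⟩
    rw [Complex.norm_of_nonneg hx, not_le] at h
    exact hz ⟨x, h, rfl⟩

theorem combGlued_eq_combInfinity_arg (h₁ : IsGeneric ρ (μ + d)) (h₂ : IsGeneric ρ (μ - d))
    (hρ : ρ.re < 1 / 2) {z : ℂ} (hz : z ∉ Complex.ofReal '' Set.Ico (0 : ℝ) 1) :
    combGlued ρ μ d z = combInfinity ρ μ d z z.arg := by
  rw [combGlued]
  split_ifs with h
  · by_cases hpos : z ∈ posCutPlane
    · exact (combInfinity_arg_eq_combZero h₁ h₂ hpos).symm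
    · rw [mem_posCutPlane_iff_notMem_image, not_not] at hpos
      obtain ⟨x, hx, rfl⟩ := hpos
      rw [Complex.norm_of_nonneg hx] at h
      obtain rfl : x = 1 := h.eq_of_not_lt fun hlt => hz ⟨x, ⟨hx, hlt⟩, rfl⟩
      rw [Complex.ofReal_one]
      exact (combInfinity_one h₁ h₂ hρ).symm
  · rfl

theorem notMem_image_Ioi_of_mem_cutPlane {z : ℂ} (hz : z ∈ cutPlane) :
    z ∉ Complex.ofReal '' Set.Ioi (1 : ℝ) :=
  fun h => hz (Set.image_mono Set.Ioi_subset_Ici_self h)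

theorem combGlued_eventuallyEq_combZero (h₁ : IsGeneric ρ (μ + d)) (h₂ : IsGeneric ρ (μ - d))
    {z : ℂ} (hz : z ∈ cutPlane) : combGlued ρ μ d =ᶠ[𝓝 z] combZero ρ μ d :=
  eventuallyEq_of_mem (isOpen_cutPlane.mem_nhds hz) fun _ hy =>
    combGlued_eq_combZero h₁ h₂ (notMem_image_Ioi_of_mem_cutPlane hy)

theorem combGlued_eventuallyEq_combInfinity_arg {z : ℂ} (hz : 1 < ‖z‖) :
    combGlued ρ μ d =ᶠ[𝓝 z] fun u => combInfinity ρ μ d u u.arg :=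
  eventuallyEq_of_mem ((isOpen_lt continuous_const continuous_norm).mem_nhds hz)
    fun _ hy => if_neg (not_le.2 hy)

theorem analyticAt_combGlued (h₁ : IsGeneric ρ (μ + d)) (h₂ : IsGeneric ρ (μ - d)) {z : ℂ}
    (h0 : z ≠ 0) (h1 : z ≠ 1) : AnalyticAt ℝ (combGlued ρ μ d) z := by
  have hμ := h₁.ne_intCast_of_add_intCast
  by_cases hz : z ∈ cutPlane
  · exact (analyticAt_combZero_comp hμ analyticAt_id (analyticAt_ofReal_norm h0) hz).congr
      (combGlued_eventuallyEq_combZero h₁ h₂ hz).symm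
  · rw [cutPlane, Set.notMem_compl_iff] at hz
    obtain ⟨x, hx, rfl⟩ := hz
    have hx1 : 1 < x := lt_of_le_of_ne hx fun h => h1 (by rw [← h, Complex.ofReal_one])
    have hnorm : 1 < ‖(x : ℂ)‖ := by rwa [Complex.norm_of_nonneg (zero_le_one.trans hx)]
    have hinv : 1 / (x : ℂ) ∈ cutPlane := ball_subset_cutPlane <| by
      rw [mem_ball_zero_iff, norm_div, norm_one]
      exact (div_lt_one (one_pos.trans hnorm)).2 hnorm
    exact (analyticAt_combInfinity_arg hμ (Complex.ofReal_mem_slitPlane.2 (one_pos.trans hx1))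
      hinv).congr (combGlued_eventuallyEq_combInfinity_arg hnorm).symm

theorem analyticAt_combGlued_sq (h₁ : IsGeneric ρ (μ + d)) (h₂ : IsGeneric ρ (μ - d)) {w : ℂ}
    (hw : w ^ 2 ≠ 1) : AnalyticAt ℝ (fun u => combGlued ρ μ d (u ^ 2)) w := by
  have hsq : AnalyticAt ℝ (fun u : ℂ => u ^ 2) w := analyticAt_id.pow 2
  rcases eq_or_ne w 0 with rfl | h0
  · have hmem : (0 : ℂ) ^ 2 ∈ cutPlane := ball_subset_cutPlane (by simp)
    exact (analyticAt_combZero_comp h₁.ne_intCast_of_add_intCast hsq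
      (analyticAt_ofReal_norm_sq 0) hmem).congr
      ((combGlued_eventuallyEq_combZero h₁ h₂ hmem).comp_tendsto hsq.continuousAt).symm
  · exact AnalyticAt.fun_comp (f := fun u : ℂ => u ^ 2)
      (analyticAt_combGlued h₁ h₂ (pow_ne_zero 2 h0) hw) hsq

theorem continuousOn_combGlued_closedBall (hμ : ∀ n : ℤ, μ ≠ n) (hρ : ρ.re < 1 / 2) (d : ℤ) :
    ContinuousOn (combGlued ρ μ d) (Metric.closedBall 0 1) :=
  (continuousOn_combZero hμ hρ d).congr fun _ hz => if_pos (mem_closedBall_zero_iff.1 hz)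

theorem continuousAt_combGlued_one (h₁ : IsGeneric ρ (μ + d)) (h₂ : IsGeneric ρ (μ - d))
    (hρ : ρ.re < 1 / 2) : ContinuousAt (combGlued ρ μ d) 1 := by
  have hμ := h₁.ne_intCast_of_add_intCast
  have heq : Set.EqOn (combGlued ρ μ d) (fun u => combInfinity ρ μ d u u.arg) {z | 1 ≤ ‖z‖} := by
    refine fun z hz => combGlued_eq_combInfinity_arg h₁ h₂ hρ ?_
    rintro ⟨x, hx, rfl⟩
    exact hx.2.not_ge (Complex.norm_of_nonneg hx.1 ▸ hz)
  have hout := (continuousWithinAt_combInfinity_arg hμ hρ d).congr heq (heq (by simp))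
  have hunion := (continuousOn_combGlued_closedBall hμ hρ d 1 (by simp)).union hout
  have huniv : Metric.closedBall (0 : ℂ) 1 ∪ {z | 1 ≤ ‖z‖} = Set.univ :=
    Set.eq_univ_of_forall fun z => (le_total ‖z‖ 1).imp_left mem_closedBall_zero_iff.2
  rwa [huniv, continuousWithinAt_univ] at hunion

theorem continuous_combGlued (h₁ : IsGeneric ρ (μ + d)) (h₂ : IsGeneric ρ (μ - d))
    (hρ : ρ.re < 1 / 2) : Continuous (combGlued ρ μ d) := by
  refine continuous_iff_continuousAt.2 fun z => ?_
  rcases eq_or_ne z 0 with rfl | h0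
  · exact (continuousOn_combGlued_closedBall h₁.ne_intCast_of_add_intCast hρ d).continuousAt
      (Metric.closedBall_mem_nhds _ one_pos)
  rcases eq_or_ne z 1 with rfl | h1
  · exact continuousAt_combGlued_one h₁ h₂ hρ
  · exact (analyticAt_combGlued h₁ h₂ h0 h1).continuousAt

end Gluing

theorem proposition3p2 (ρ μ : ℂ) (d : ℤ)
    (hμ : ∀ n : ℤ, μ ≠ n)
    (hpp : ∀ n : ℕ, ρ + μ + d ≠ -n) (hpm : ∀ n : ℕ, ρ + μ - d ≠ -n)
    (hmp : ∀ n : ℕ, ρ - μ + d ≠ -n) (hmm : ∀ n : ℕ, ρ - μ - d ≠ -n) :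
    (∀ (z : ℂ) (θ : ℝ), z ≠ 0 → θ ∈ Set.Ioo 0 (2 * Real.pi) →
      z = ‖z‖ * Complex.exp (θ * Complex.I) →
      combInfinity ρ μ d z θ = combZero ρ μ d z) ∧
    (ρ.re < 1 / 2 →
      ∃ f : ℂ → ℂ,
        (∀ (z : ℂ) (θ : ℝ), z ∉ Complex.ofReal '' Set.Ico (0 : ℝ) 1 →
          z = ‖z‖ * Complex.exp (θ * Complex.I) → f z = combInfinity ρ μ d z θ) ∧
        (∀ z : ℂ, z ∉ Complex.ofReal '' Set.Ioi (1 : ℝ) → f z = combZero ρ μ d z) ∧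
        Continuous f ∧
        (∀ z : ℂ, z ≠ 0 → z ≠ 1 → AnalyticAt ℝ f z) ∧
        (∀ w : ℂ, w ^ 2 ≠ 1 → AnalyticAt ℝ (fun u : ℂ => f (u ^ 2)) w)) := by
  have h₁ : IsGeneric ρ (μ + d) := ⟨add_intCast_ne_intCast hμ d,
    fun n => (add_assoc ρ μ d).symm.trans_ne (hpp n),
    fun n => (sub_sub ρ μ d).symm.trans_ne (hmm n)⟩
  have h₂ : IsGeneric ρ (μ - d) := ⟨sub_intCast_ne_intCast hμ d,
    fun n => (add_sub_assoc ρ μ d).symm.trans_ne (hpm n),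
    fun n => (sub_sub_eq_add_sub ρ μ d).trans_ne (add_sub_right_comm ρ d μ ▸ hmp n)⟩
  refine ⟨fun z θ hz hθ h => combInfinity_eq_combZero h₁ h₂ hz hθ h, fun hρ =>
    ⟨combGlued ρ μ d, fun z θ hz h => ?_, fun z hz => combGlued_eq_combZero h₁ h₂ hz,
      continuous_combGlued h₁ h₂ hρ, fun z h0 h1 => analyticAt_combGlued h₁ h₂ h0 h1,
      fun w hw => analyticAt_combGlued_sq h₁ h₂ hw⟩⟩
  have hz0 : z ≠ 0 := fun h0 => hz ⟨0, ⟨le_rfl, one_pos⟩, h0 ▸ Complex.ofReal_zero⟩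
  rw [combGlued_eq_combInfinity_arg h₁ h₂ hρ hz]
  exact combInfinity_congr_arg ρ μ d hz0 (Complex.norm_mul_exp_arg_mul_I z).symm h
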